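/- Let $k$ be a field (of any characteristic). A Hurwitz algebra over $k$ is a non-zero, finite-dimensional, unital, not necessarily associative $k$-algebra $A$ with a quadratic form $n:A\to k$ such that $n(ab)=n(a)n(b)$ for all $a,b\in A$ and such that the polar form $\langle x,y\rangle=n(x+y)-n(x)-n(y)$ is non-degenerate ($\langle x,A\rangle=0$ only if $x=0$). Let $A=(A,n)$ be a Hurwitz algebra. *Isotopes.* For $\alpha,\beta\in GL(A)$ the principal isotope $A_{\alpha,\beta}$ is the vector space $A$ with the multiplication $x\circ y=\alpha(x)\beta(y)$. Let $\check{\mathscr I}(A)$ be the groupoid whose objects are the principal isotopes of $A$ (two isotopes being equal if their multiplications are) and whose morphisms are the algebra isomorphisms between them. *Groups.* A similitude of $A$ with multiplier $\mu\in k^*$ is a map $\varphi\in GL(A)$ with $n(\varphi(x))=\mu\, n(x)$ for all $x$; these maps form the group $GO(A)$. If $\operatorname{char}k\ne2$, a similitude $\varphi$ with multiplier $\mu$ is proper if $\det\varphi=\mu^{\dim A/2}$; if $\operatorname{char}k=2$, it is proper if its Dickson invariant $\operatorname{tr}(\ell(\varphi\ell\varphi^{-1}-\ell))$ is zero, where $\ell$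 is any endomorphism of $A$ with $\langle\ell x,x\rangle=n(x)$ for all $x$. Let $GO^+(A)$ be the group of proper similitudes, $G(A)=GO(A)$ if $\dim A\le2$ and $G(A)=GO^+(A)$ if $\dim A\ge4$ (every Hurwitz algebra has dimension $1$, $2$, $4$ or $8$), and put $PG(A)=G(A)/k^*\mathbb I$ and $PGL(A)=GL(A)/k^*\mathbb I$. Triality components of $\varphi$ are $\varphi_1,\varphi_2\in GO(A)$ with $\varphi(xy)=\varphi_1(x)\varphi_2(y)$ for all $x,y\in A$. *The action.* Let $N(A)$ be the nucleus of $A$, i.e. the set of all $a\in A$ such that $(xy)z=x(yz)$ whenever $a\in\{x,y,z\}$, and let $N(A)^*$ be its group of invertible elements. With $L_w(x)=wx$ and $R_w(x)=xw$, let $X_A=PGL(A)^2/N(A)^*$ be the orbit set of the action $w\cdot(\alpha,\beta)=(R_w^{-1}\alpha,L_w\beta)$. **Theorem.** Every $\varphi\in G(A)$ has triality components, and $$\varphi\cdot(\alpha,\beta)=(\varphi_1\alpha\varphi^{-1},\varphi_2\beta\varphi^{-1}),$$ where $\varphi_1,\varphi_2$ are any triality components of $\varphi$, is a well-defined action of the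 group $PG(A)$ on $X_A$. Let $\mathscr X(A)$ be the groupoid of this action: its objects are the elements of $X_A$, and its morphisms $x\to y$ are the $g\in PG(A)$ with $g\cdot x=y$. Then the categories $\check{\mathscr I}(A)$ and $\mathscr X(A)$ are equivalent. More precisely, every isomorphism between principal isotopes of $A$ lies in $G(A)$, and sending $A_{\alpha,\beta}$ to the class of $(\alpha,\beta)$ in $X_A$ and an isomorphism $\varphi$ to the class of $\varphi$ in $PG(A)$ is a well-defined functor $\mathscr F_A:\check{\mathscr I}(A)\to\mathscr X(A)$ that is an equivalence of categories. -/

import Mathlib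

open CategoryTheory

noncomputable section

namespace HurwitzIsotope

universe u v

/-! ### Quadratic spaces and similitudes -/

section Quadratic

variable {k : Type u} {V : Type v} [Field k] [AddCommGroup V] [Module k V]

/-- The quadratic form `q` is non-degenerate: its polar form has trivial radical. -/
def NonDegenerate (q : QuadraticForm k V) : Prop :=
  ∀ x : V, (∀ y : V, QuadraticMap.polar q x y = 0) → x = 0

/-- The linear automorphism `φ` is a similitude of `q` with multiplier `m`. -/
def HasMultiplier (q : QuadraticForm k V) (φ : V ≃ₗ[k] V) (m : kˣ) : Prop :=
  ∀ x : V, q (φ x) = (m : k) * q x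

theorem HasMultiplier.mul {q : QuadraticForm k V} {φ ψ : V ≃ₗ[k] V} {m m' : kˣ}
    (h : HasMultiplier q φ m) (h' : HasMultiplier q ψ m') :
    HasMultiplier q (φ * ψ) (m * m') := by
  intro x
  rw [LinearEquiv.mul_apply, h, h', Units.val_mul, mul_assoc]

theorem HasMultiplier.one (q : QuadraticForm k V) : HasMultiplier q 1 1 := by
  intro x
  simp

theorem HasMultiplier.inv {q : QuadraticForm k V} {φ : V ≃ₗ[k] V} {m : kˣ}
    (h : HasMultiplier q φ m) : HasMultiplier q φ⁻¹ m⁻¹ := by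
  intro x
  have h1 : φ (φ⁻¹ x) = x := φ.apply_symm_apply x
  have h2 := h (φ⁻¹ x)
  rw [h1] at h2
  rw [h2, Units.inv_mul_cancel_left]

/-- The group `GO(V, q)` of similitudes. -/
def GO (q : QuadraticForm k V) : Subgroup (V ≃ₗ[k] V) where
  carrier := {φ | ∃ m : kˣ, HasMultiplier q φ m}
  mul_mem' := by
    rintro _ _ ⟨m, h⟩ ⟨m', h'⟩
    exact ⟨_, h.mul h'⟩
  one_mem' := ⟨1, HasMultiplier.one q⟩
  inv_mem' := by
    rintro _ ⟨m, h⟩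
    exact ⟨_, h.inv⟩

/-- The endomorphism `l` satisfies `⟨l x, x⟩ = q x` for all `x`. In characteristic two this says
that `s ↦ tr (l s)` is the linear form on the space of self-adjoint endomorphisms (for the polar
form) that belongs to `q`, i.e. the one taking the value `q v` at `x ↦ ⟨v, x⟩ v`. -/
def Represents (q : QuadraticForm k V) (l : Module.End k V) : Prop :=
  ∀ x : V, QuadraticMap.polar q (l x) x = q x

/-- The Dickson invariant `tr (l (φ l φ⁻¹ - l))` of a similitude `φ` of a non-degenerate form `q`
in characteristic two, computed with an endomorphism `l` representing `q`; it takes the values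
`0` and `1` and does not depend on the choice of `l`. -/
def dickson (l : Module.End k V) (φ : V ≃ₗ[k] V) : k :=
  LinearMap.trace k V
    (l * ((φ : V →ₗ[k] V) * l * ((φ⁻¹ : V ≃ₗ[k] V) : V →ₗ[k] V) - l))

/-- The similitude `φ` with multiplier `m` is proper: if `2 ≠ 0` in `k` this means
`det φ = m ^ (dim V / 2)`, and if `2 = 0` in `k` it means that the Dickson invariant vanishes. -/
def ProperWith (q : QuadraticForm k V) (φ : V ≃ₗ[k] V) (m : kˣ) : Prop :=
  ((2 : k) ≠ 0 → LinearMap.det (φ : V →ₗ[k] V) = (m : k) ^ (Module.finrank k V / 2)) ∧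
  ((2 : k) = 0 → ∀ l : Module.End k V, Represents q l → dickson l φ = 0)

theorem matrix_trace_zero {ι : Type*} [Fintype ι] (h2 : (2 : k) = 0) (C T : Matrix ι ι k)
    (hC : C.transpose = C) (hT : T.transpose = T) (hT0 : ∀ i, T i i = 0) :
    (C * T).trace = 0 := by
  classical
  simp only [Matrix.trace, Matrix.diag, Matrix.mul_apply]
  rw [← Finset.sum_product']
  have hC' : ∀ i j, C i j = C j i := fun i j => congrFun (congrFun hC.symm i) j
  have hT' : ∀ i j, T i j = T j i := fun i j => congrFun (congrFun hT.symm i) j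
  refine Finset.sum_involution (fun p _ => (p.2, p.1)) ?_ ?_ ?_ ?_
  · rintro ⟨i, j⟩ _
    simp only
    rw [hC' j i, hT' i j, ← two_mul, h2, zero_mul]
  · rintro ⟨i, j⟩ _ hne heq
    simp only [Prod.mk.injEq] at heq
    obtain ⟨rfl, _⟩ := heq
    exact hne (by simp [hT0])
  · intro a ha
    simp
  · intro a ha
    rfl

theorem trace_alternating_mul [FiniteDimensional k V] {q : QuadraticForm k V}
    (hq : NonDegenerate q) (h2 : (2 : k) = 0) (s t : Module.End k V)
    (hs : ∀ x, QuadraticMap.polar q (s x) x = 0) (ht : ∀ x, QuadraticMap.polar q (t x) x = 0) :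
    LinearMap.trace k V (s * t) = 0 := by
  classical
  have hneg : ∀ a b : k, a + b = 0 → a = b := by
    intro a b hab
    linear_combination hab - b * h2
  let e := Module.finBasis k V
  let b : LinearMap.BilinForm k V := q.polarBilin
  have hb : ∀ x y, b x y = QuadraticMap.polar q x y := fun x y => rfl
  have hbs : ∀ x y, b x y = b y x := fun x y => QuadraticMap.polar_comm q x y
  have hnd : b.Nondegenerate := by
    refine ⟨fun x hx => hq x hx, fun y hy => hq y fun x => ?_⟩
    have := hy x
    rw [hbs] at this
    exact this
  have hsym : ∀ r : Module.End k V, (∀ x, QuadraticMap.polar q (r x) x = 0) →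
      ∀ x y, b (r x) y = b (r y) x := by
    intro r hr x y
    apply hneg
    have h1 : b (r (x + y)) (x + y) = 0 := hr (x + y)
    have h2 : b (r x) x = 0 := hr x
    have h3 : b (r y) y = 0 := hr y
    simp only [map_add, LinearMap.add_apply, h2, h3] at h1
    linear_combination h1
  let B := LinearMap.BilinForm.toMatrix e b
  have hBdet : IsUnit B.det :=
    isUnit_iff_ne_zero.mpr ((LinearMap.BilinForm.nondegenerate_iff_det_ne_zero e).mp hnd)
  have hBt : B.transpose = B := by
    ext i j
    simp [B, Matrix.transpose_apply, hbs (e j) (e i)]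
  have key : ∀ r : Module.End k V, (∀ x, QuadraticMap.polar q (r x) x = 0) →
      ∃ S : Matrix _ _ k, S.transpose = S ∧ (∀ i, S i i = 0) ∧
        LinearMap.toMatrix e e r = B⁻¹ * S := by
    intro r hr
    have hS : ∀ i j, (B * LinearMap.toMatrix e e r) i j = b (e i) (r (e j)) := by
      intro i j
      have h := congrFun (congrFun (LinearMap.BilinForm.toMatrix_compRight e b r) i) j
      rw [LinearMap.BilinForm.toMatrix_apply] at h
      exact h.symm
    refine ⟨B * LinearMap.toMatrix e e r, ?_, ?_, ?_⟩
    · ext i j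
      rw [Matrix.transpose_apply, hS, hS, hbs, hsym r hr, hbs]
    · intro i
      rw [hS, hbs]
      exact hr _
    · rw [Matrix.nonsing_inv_mul_cancel_left _ _ hBdet]
  obtain ⟨S, hS, -, hsS⟩ := key s hs
  obtain ⟨T, hT, hT0, htT⟩ := key t ht
  have hBi : B⁻¹.transpose = B⁻¹ := by
    rw [Matrix.transpose_nonsing_inv, hBt]
  rw [LinearMap.trace_eq_matrix_trace k e, LinearMap.toMatrix_mul, hsS, htT, ← Matrix.mul_assoc]
  refine matrix_trace_zero h2 _ _ ?_ hT hT0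
  rw [Matrix.transpose_mul, Matrix.transpose_mul, hBi, hS, Matrix.mul_assoc]

/-- The endomorphism `φ l φ⁻¹`. -/
def conj (φ : V ≃ₗ[k] V) (l : Module.End k V) : Module.End k V :=
  (φ : V →ₗ[k] V) * l * ((φ⁻¹ : V ≃ₗ[k] V) : V →ₗ[k] V)

theorem represents_conj {q : QuadraticForm k V} {φ : V ≃ₗ[k] V} {m : kˣ}
    (h : HasMultiplier q φ m) {l : Module.End k V} (hl : Represents q l) :
    Represents q (conj φ l) := by
  intro x
  have h1 : φ (φ⁻¹ x) = x := φ.apply_symm_apply x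
  have hp : ∀ a b, QuadraticMap.polar q (φ a) (φ b) = (m : k) * QuadraticMap.polar q a b := by
    intro a b
    simp only [QuadraticMap.polar, ← map_add, h a, h b, h (a + b)]
    ring
  have h3 : conj φ l x = φ (l (φ⁻¹ x)) := rfl
  have h4 := hp (l (φ⁻¹ x)) (φ⁻¹ x)
  rw [h1, hl, ← h, h1] at h4
  rw [h3, h4]

theorem conj_mul (φ ψ : V ≃ₗ[k] V) (l : Module.End k V) :
    conj (φ * ψ) l = conj φ (conj ψ l) := by
  rw [conj, conj, conj, mul_inv_rev]
  rfl

theorem conj_inv_conj (φ : V ≃ₗ[k] V) (l : Module.End k V) : conj φ (conj φ⁻¹ l) = l := by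
  rw [← conj_mul, mul_inv_cancel]
  rfl

theorem conj_sub (φ : V ≃ₗ[k] V) (l l' : Module.End k V) :
    conj φ (l - l') = conj φ l - conj φ l' := by
  simp only [conj, mul_sub, sub_mul]

theorem trace_conj_mul (φ : V ≃ₗ[k] V) (l s : Module.End k V) :
    LinearMap.trace k V (l * conj φ s) = LinearMap.trace k V (conj φ⁻¹ l * s) := by
  simp only [conj, inv_inv]
  rw [← mul_assoc, LinearMap.trace_mul_comm]
  simp only [mul_assoc]

theorem Represents.sub_alternating {q : QuadraticForm k V} {l l' : Module.End k V}
    (hl : Represents q l) (hl' : Represents q l') (x : V) :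
    QuadraticMap.polar q ((l - l') x) x = 0 := by
  have h := congrFun (congrArg DFunLike.coe (map_sub q.polarBilin (l x) (l' x))) x
  rw [LinearMap.sub_apply]
  refine h.trans ?_
  have h1 : q.polarBilin (l x) x = q x := hl x
  have h2 : q.polarBilin (l' x) x = q x := hl' x
  rw [LinearMap.sub_apply, h1, h2, sub_self]

theorem dickson_mul [FiniteDimensional k V] {q : QuadraticForm k V} (hq : NonDegenerate q)
    (h2 : (2 : k) = 0) {l : Module.End k V} (hl : Represents q l) {φ ψ : V ≃ₗ[k] V} {m m' : kˣ}
    (hφ : HasMultiplier q φ m) (hψ : HasMultiplier q ψ m') :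
    dickson l (φ * ψ) = dickson l φ + dickson l ψ := by
  have e1 : ∀ χ : V ≃ₗ[k] V, dickson l χ = LinearMap.trace k V (l * (conj χ l - l)) :=
    fun χ => rfl
  have e2 : l * (conj (φ * ψ) l - l) =
      l * conj φ (conj ψ l - l) + l * (conj φ l - l) := by
    rw [conj_sub, conj_mul, ← mul_add]
    congr 1
    abel
  have e3 : conj φ⁻¹ l * (conj ψ l - l) =
      (conj φ⁻¹ l - l) * (conj ψ l - l) + l * (conj ψ l - l) := by
    rw [sub_mul, sub_add_cancel]
  rw [e1, e1, e1, e2, map_add, trace_conj_mul, e3, map_add,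
    trace_alternating_mul hq h2 _ _
      ((represents_conj hφ.inv hl).sub_alternating hl)
      ((represents_conj hψ hl).sub_alternating hl), zero_add, add_comm]

theorem dickson_one (l : Module.End k V) : dickson l (1 : V ≃ₗ[k] V) = 0 := by
  have : l * (conj (1 : V ≃ₗ[k] V) l - l) = 0 := by
    have : conj (1 : V ≃ₗ[k] V) l = l := rfl
    rw [this, sub_self, mul_zero]
  exact (congrArg (LinearMap.trace k V) this).trans (map_zero _)

/-- The group `GO⁺(V, q)` of proper similitudes of a non-degenerate quadratic space. -/
def GOplus [FiniteDimensional k V] (q : QuadraticForm k V) (hq : NonDegenerate q) :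
    Subgroup (V ≃ₗ[k] V) where
  carrier := {φ | ∃ m : kˣ, HasMultiplier q φ m ∧ ProperWith q φ m}
  mul_mem' := by
    rintro φ ψ ⟨m, h, hd, hD⟩ ⟨m', h', hd', hD'⟩
    refine ⟨m * m', h.mul h', fun h2 => ?_, fun h2 l hl => ?_⟩
    · have e : ((φ * ψ : V ≃ₗ[k] V) : V →ₗ[k] V) = (φ : V →ₗ[k] V) * (ψ : V →ₗ[k] V) := rfl
      rw [e, map_mul, hd h2, hd' h2, Units.val_mul, mul_pow]
    · rw [dickson_mul hq h2 hl h h', hD h2 l hl, hD' h2 l hl, add_zero]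
  one_mem' := by
    refine ⟨1, HasMultiplier.one q, fun _ => ?_, fun _ l _ => dickson_one l⟩
    have e : ((1 : V ≃ₗ[k] V) : V →ₗ[k] V) = 1 := rfl
    rw [e, map_one, Units.val_one, one_pow]
  inv_mem' := by
    rintro φ ⟨m, h, hd, hD⟩
    refine ⟨m⁻¹, h.inv, fun h2 => ?_, fun h2 l hl => ?_⟩
    · have e : ((φ⁻¹ : V ≃ₗ[k] V) : V →ₗ[k] V) * (φ : V →ₗ[k] V) = 1 := by
        ext x
        exact φ.symm_apply_apply x
      have e' := congrArg LinearMap.det e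
      rw [map_mul, map_one, hd h2] at e'
      rw [eq_inv_of_mul_eq_one_left e', Units.val_inv_eq_inv_val, inv_pow]
    · have e := dickson_mul hq h2 hl h h.inv
      rw [mul_inv_cancel, dickson_one, hD h2 l hl, zero_add] at e
      exact e.symm

end Quadratic

/-! ### Projective groups -/

section Projective

variable (k : Type u) (V : Type v) [Field k] [AddCommGroup V] [Module k V]

/-- The subgroup `k* I` of homotheties in `GL(V)`. -/
def homotheties : Subgroup (V ≃ₗ[k] V) :=
  (DistribMulAction.toModuleAut k V : kˣ →* (V ≃ₗ[k] V)).range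

instance homotheties_normal : (homotheties k V).Normal where
  conj_mem := by
    rintro _ ⟨r, rfl⟩ φ
    refine ⟨r, ?_⟩
    ext x
    have h1 : φ (φ⁻¹ x) = x := φ.apply_symm_apply x
    change (r : k) • x = φ ((r : k) • φ⁻¹ x)
    rw [map_smul, h1]

/-- `PGL(V) = GL(V) / k* I`. -/
abbrev PGL : Type v := (V ≃ₗ[k] V) ⧸ homotheties k V

end Projective

/-! ### Hurwitz algebras -/

section Nucleus

variable (A : Type v) [NonAssocRing A]

/-- The nucleus `N(A)`: the elements that associate with all pairs of elements, in every
position. -/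
def nucleus : Subring A where
  carrier := {a | ∀ x y : A, (a * x) * y = a * (x * y) ∧ (x * a) * y = x * (a * y) ∧
    (x * y) * a = x * (y * a)}
  mul_mem' := by
    intro a b ha hb x y
    refine ⟨?_, ?_, ?_⟩
    · rw [(ha b x).1, (ha (b * x) y).1, (hb x y).1, (ha b (x * y)).1]
    · rw [← (ha x b).2.1, (hb (x * a) y).2.1, (ha x (b * y)).2.1, (ha b y).1]
    · rw [← (hb (x * y) a).2.2, (ha x y).2.2, (hb x (y * a)).2.2, (hb y a).2.2]
  one_mem' := by
    intro x y
    simp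
  add_mem' := by
    intro a b ha hb x y
    refine ⟨?_, ?_, ?_⟩
    · simp only [add_mul, (ha x y).1, (hb x y).1]
    · simp only [add_mul, mul_add, (ha x y).2.1, (hb x y).2.1]
    · simp only [mul_add, (ha x y).2.2, (hb x y).2.2]
  zero_mem' := by
    intro x y
    simp
  neg_mem' := by
    intro a ha x y
    refine ⟨?_, ?_, ?_⟩
    · simp only [neg_mul, (ha x y).1]
    · simp only [neg_mul, mul_neg, (ha x y).2.1]
    · simp only [mul_neg, (ha x y).2.2]

/-- The nucleus is associative, so that it has a unit group `N(A)* = (nucleus A)ˣ`. -/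
instance nucleusMonoid : Monoid (nucleus A) where
  mul_assoc a b c := Subtype.ext (a.2 b c).1
  one_mul a := Subtype.ext (one_mul (a : A))
  mul_one a := Subtype.ext (mul_one (a : A))

end Nucleus

section Algebra

variable (k : Type u) (A : Type v) [Field k] [NonAssocRing A] [Module k A]
  [SMulCommClass k A A] [IsScalarTower k A A]

variable {A} in
/-- Left multiplication `L_w` by an invertible element `w` of the nucleus. -/
def leftMul (w : (nucleus A)ˣ) : A ≃ₗ[k] A where
  toFun x := ((w : nucleus A) : A) * x
  map_add' x y := mul_add _ x y
  map_smul' r x := mul_smul_comm r _ x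
  invFun x := ((w⁻¹ : (nucleus A)ˣ) : nucleus A) * x
  left_inv x := by
    have h : (((w⁻¹ : (nucleus A)ˣ) : nucleus A) : A) * ((w : nucleus A) : A) = 1 :=
      congrArg Subtype.val w.inv_mul
    simp only
    rw [← (((w⁻¹ : (nucleus A)ˣ) : nucleus A).2 _ x).1, h, one_mul]
  right_inv x := by
    have h : ((w : nucleus A) : A) * (((w⁻¹ : (nucleus A)ˣ) : nucleus A) : A) = 1 :=
      congrArg Subtype.val w.mul_inv
    simp only
    rw [← ((w : nucleus A).2 _ x).1, h, one_mul]

variable {A} in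
/-- Right multiplication `R_w` by an invertible element `w` of the nucleus. -/
def rightMul (w : (nucleus A)ˣ) : A ≃ₗ[k] A where
  toFun x := x * ((w : nucleus A) : A)
  map_add' x y := add_mul x y _
  map_smul' r x := smul_mul_assoc r x _
  invFun x := x * (((w⁻¹ : (nucleus A)ˣ) : nucleus A) : A)
  left_inv x := by
    have h : ((w : nucleus A) : A) * (((w⁻¹ : (nucleus A)ˣ) : nucleus A) : A) = 1 :=
      congrArg Subtype.val w.mul_inv
    simp only
    rw [((w : nucleus A).2 x _).2.1, h, mul_one]
  right_inv x := by
    have h : (((w⁻¹ : (nucleus A)ˣ) : nucleus A) : A) * ((w : nucleus A) : A) = 1 :=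
      congrArg Subtype.val w.inv_mul
    simp only
    rw [(((w⁻¹ : (nucleus A)ˣ) : nucleus A).2 x _).2.1, h, mul_one]

theorem leftMul_one : leftMul k (1 : (nucleus A)ˣ) = 1 := by
  ext x
  exact one_mul x

theorem rightMul_one : rightMul k (1 : (nucleus A)ˣ) = 1 := by
  ext x
  exact mul_one x

theorem leftMul_mul (w z : (nucleus A)ˣ) :
    leftMul k (w * z) = leftMul k w * leftMul k z := by
  ext x
  exact ((w : nucleus A).2 _ x).1

theorem rightMul_mul (w z : (nucleus A)ˣ) :
    rightMul k (w * z) = rightMul k z * rightMul k w := by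
  ext x
  exact ((w : nucleus A).2 x _).2.1.symm

/-- The action `w · (α, β) = (R_w⁻¹ α, L_w β)` of `N(A)*` on `PGL(A)²`. -/
instance nuclearAction : MulAction (nucleus A)ˣ (PGL k A × PGL k A) where
  smul w p := ((((rightMul k w)⁻¹ : A ≃ₗ[k] A) : PGL k A) * p.1, (leftMul k w : PGL k A) * p.2)
  one_smul p := by
    change ((((rightMul k (1 : (nucleus A)ˣ))⁻¹ : A ≃ₗ[k] A) : PGL k A) * p.1,
      (leftMul k (1 : (nucleus A)ˣ) : PGL k A) * p.2) = p
    rw [leftMul_one, rightMul_one, inv_one, QuotientGroup.mk_one, one_mul, one_mul]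
  mul_smul w z p := by
    change ((((rightMul k (w * z))⁻¹ : A ≃ₗ[k] A) : PGL k A) * p.1,
        (leftMul k (w * z) : PGL k A) * p.2) =
      ((((rightMul k w)⁻¹ : A ≃ₗ[k] A) : PGL k A) *
          ((((rightMul k z)⁻¹ : A ≃ₗ[k] A) : PGL k A) * p.1),
        (leftMul k w : PGL k A) * ((leftMul k z : PGL k A) * p.2))
    rw [leftMul_mul, rightMul_mul, mul_inv_rev, QuotientGroup.mk_mul, QuotientGroup.mk_mul,
      mul_assoc, mul_assoc]

/-- The orbit set `X_A = PGL(A)² / N(A)*`. -/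
def XSet : Type v := MulAction.orbitRel.Quotient (nucleus A)ˣ (PGL k A × PGL k A)

variable {k A} in
/-- The element of `X_A` represented by `(α, β) ∈ GL(A)²`. -/
def XSet.mk (α β : A ≃ₗ[k] A) : XSet k A :=
  Quotient.mk (MulAction.orbitRel (nucleus A)ˣ (PGL k A × PGL k A)) ((α : PGL k A), (β : PGL k A))

/-! ### Principal isotopes -/

/-- A principal isotope of `A`: an algebra structure on the vector space `A` whose
multiplication is `x ∘ y = α(x) β(y)` for some `α, β ∈ GL(A)`. Two isotopes are equal if and only
if their multiplications are. -/
@[ext]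
structure PrincipalIsotope where
  /-- the multiplication of the isotope -/
  mul : A →ₗ[k] A →ₗ[k] A
  exists_isotopy : ∃ α β : A ≃ₗ[k] A, ∀ x y : A, mul x y = α x * β y

variable {k A} in
/-- The principal isotope `A_{α,β}`. -/
def isotope (α β : A ≃ₗ[k] A) : PrincipalIsotope k A where
  mul := (LinearMap.mul k A).compl₁₂ (α : A →ₗ[k] A) (β : A →ₗ[k] A)
  exists_isotopy := ⟨α, β, fun _ _ => rfl⟩

variable {k A} in
/-- Isomorphisms of principal isotopes: linear bijections compatible with the
multiplications. -/
@[ext]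
structure PrincipalIsotope.Iso (B C : PrincipalIsotope k A) where
  /-- the underlying linear bijection -/
  toLinearEquiv : A ≃ₗ[k] A
  map_mul : ∀ x y : A, toLinearEquiv (B.mul x y) = C.mul (toLinearEquiv x) (toLinearEquiv y)

/-- The groupoid of principal isotopes of `A` and their isomorphisms. -/
instance isotopeGroupoid : Groupoid (PrincipalIsotope k A) where
  Hom B C := PrincipalIsotope.Iso B C
  id B := ⟨LinearEquiv.refl k A, fun _ _ => rfl⟩
  comp f g := ⟨f.toLinearEquiv.trans g.toLinearEquiv, fun x y => by
    simp only [LinearEquiv.trans_apply, f.map_mul, g.map_mul]⟩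
  inv f := ⟨f.toLinearEquiv.symm, fun x y => by
    apply f.toLinearEquiv.injective
    simp only [f.map_mul, LinearEquiv.apply_symm_apply]⟩
  inv_comp f := PrincipalIsotope.Iso.ext (LinearEquiv.symm_trans_self f.toLinearEquiv)
  comp_inv f := PrincipalIsotope.Iso.ext (LinearEquiv.self_trans_symm f.toLinearEquiv)

/-! ### The group `PG(A)` and the triality action -/

variable {k A}

/-- The non-zero unital algebra `A` is a Hurwitz algebra with norm `n`. -/
structure IsHurwitz (n : QuadraticForm k A) : Prop where
  nontrivial : Nontrivial A
  nonDegenerate : NonDegenerate n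
  map_mul : ∀ a b : A, n (a * b) = n a * n b

/-- The similitudes `φ₁`, `φ₂` are triality components of `φ`. -/
structure IsTriality (n : QuadraticForm k A) (φ φ₁ φ₂ : A ≃ₗ[k] A) : Prop where
  mem_left : φ₁ ∈ GO n
  mem_right : φ₂ ∈ GO n
  map_mul : ∀ x y : A, φ (x * y) = φ₁ x * φ₂ y

variable [FiniteDimensional k A]

/-- The group `G(A)`: all similitudes if `dim A ≤ 2`, and the proper ones otherwise. -/
def G (n : QuadraticForm k A) (h : IsHurwitz n) : Subgroup (A ≃ₗ[k] A) :=
  if Module.finrank k A ≤ 2 then GO n else GOplus n h.nonDegenerate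

/-- `PG(A) = G(A) / k* I`. -/
abbrev PG (n : QuadraticForm k A) (h : IsHurwitz n) : Type v :=
  G n h ⧸ (homotheties k A).subgroupOf (G n h)

/-- The given action of `PG(A)` on `X_A` is the triality action: every `φ ∈ G(A)` has triality
components, and `φ · (α, β) = (φ₁ α φ⁻¹, φ₂ β φ⁻¹)` for every choice `φ₁`, `φ₂` of them. -/
structure IsTrialityAction (n : QuadraticForm k A) (h : IsHurwitz n)
    (act : MulAction (PG n h) (XSet k A)) : Prop where
  exists_components : ∀ φ : G n h, ∃ φ₁ φ₂ : A ≃ₗ[k] A, IsTriality n φ φ₁ φ₂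
  smul_mk : ∀ (φ : G n h) (φ₁ φ₂ : A ≃ₗ[k] A), IsTriality n φ φ₁ φ₂ → ∀ α β : A ≃ₗ[k] A,
    act.smul (φ : PG n h) (XSet.mk α β) =
      XSet.mk (φ₁ * α * (φ : A ≃ₗ[k] A)⁻¹) (φ₂ * β * (φ : A ≃ₗ[k] A)⁻¹)

end Algebra

end HurwitzIsotope

end

/-!
Put `𝒯 = {φ ∈ GL(A) | φ(xy) = φ₁(x) φ₂(y) for some φ₁, φ₂ ∈ GL(A)}`. An isomorphism between
principal isotopes is visibly an element of `𝒯`, and `𝒯` acts on the principal isotopes by transport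
of structure. Two isotopes have the same class in `X_A` precisely when their multiplications are
proportional, since the isotopies of `A` onto itself come from the nucleus. Hence the action
descends to `X_A`, and it yields a functor that is faithful and full because an element of `𝒯` can
be rescaled. The theorem is thus the equality `𝒯 = G(A)`.

Here `𝒯 ⊆ GO(A)` because a Hurwitz algebra has only one Hurwitz norm. Conversely a similitude is a
left multiplication times an isometry fixing `1`, and by Cartan–Dieudonné the latter is a product of
reflections. Left multiplications and products of two reflections lie in `𝒯` by the Moufang
identities, and in `GO⁺(A)` if `dim A > 2`, so both groups have index at most two in `GO(A)` and the
question is which of them contain the reflection `-bar` in `1`. It is improper, and it is in `𝒯`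
only if `A` is isotopic to its opposite, that is, if `A` is commutative, that is, if `dim A ≤ 2`.
-/

namespace HurwitzIsotope

open QuadraticMap

/-! ### Composition identities -/

section Identities

variable {k A V : Type*} [Field k] [AddCommGroup V] [Module k V]
  [NonAssocRing A] [Module k A] {n : QuadraticForm k A}

theorem NonDegenerate.ext {q : QuadraticForm k V} (hq : NonDegenerate q) {x y : V}
    (hxy : ∀ z, polar q x z = polar q y z) : x = y :=
  sub_eq_zero.mp (hq _ fun z => by rw [polar_sub_left, hxy, sub_self])

/-- The standard involution `x ↦ ⟨x, 1⟩ 1 - x` of a Hurwitz algebra with norm `n`. -/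
def bar (n : QuadraticForm k A) : A →ₗ[k] A :=
  (n.polarBilin.flip 1).smulRight 1 - LinearMap.id

theorem bar_apply (x : A) : bar n x = polar n x 1 • (1 : A) - x := rfl

/-- The inverse `n(a)⁻¹ ā` of an element `a` of a Hurwitz algebra; it is `0` if `n a = 0`. -/
def inverse (n : QuadraticForm k A) (a : A) : A := (n a)⁻¹ • bar n a

theorem polar_bar_left (x y : A) : polar n (bar n x) y = polar n x (bar n y) := by
  simp only [bar_apply, polar_sub_left, polar_sub_right, polar_smul_left, polar_smul_right,
    smul_eq_mul, polar_comm n 1 y]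
  ring

namespace IsHurwitz

theorem smul_one_injective (h : IsHurwitz n) : Function.Injective fun c : k => c • (1 : A) :=
  have := h.nontrivial
  smul_left_injective k one_ne_zero

theorem map_one (h : IsHurwitz n) : n 1 = 1 := by
  have := h.nontrivial
  have mul_n_one : ∀ x, n x = n 1 * n x := fun x => by rw [← h.map_mul, one_mul]
  by_contra hne
  have n_one : n 1 = 0 :=
    (mul_eq_zero.mp (by linear_combination -mul_n_one 1 : n 1 * (n 1 - 1) = 0)).resolve_right
      (sub_ne_zero.mpr hne)
  have n_zero : ∀ x, n x = 0 := fun x => by rw [mul_n_one, n_one, zero_mul]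
  exact one_ne_zero (h.nonDegenerate (1 : A) fun y => by
    simp only [polar, n_zero, sub_self])

theorem map_smul_one (h : IsHurwitz n) (c : k) : n (c • (1 : A)) = c * c := by
  rw [QuadraticMap.map_smul, h.map_one, smul_eq_mul, mul_one]

theorem polar_one_one (h : IsHurwitz n) : polar n (1 : A) 1 = 2 := by
  rw [polar_self, h.map_one, nsmul_eq_mul, mul_one, Nat.cast_ofNat]

theorem polar_mul_left (h : IsHurwitz n) (x y z : A) :
    polar n (x * y) (x * z) = n x * polar n y z := by
  simp only [polar, ← mul_add, h.map_mul]
  ring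

theorem polar_mul_right (h : IsHurwitz n) (x y z : A) :
    polar n (x * z) (y * z) = polar n x y * n z := by
  simp only [polar, ← add_mul, h.map_mul]
  ring

theorem polar_mul_mul (h : IsHurwitz n) (x y z w : A) :
    polar n (x * y) (z * w) + polar n (x * w) (z * y) = polar n x z * polar n y w := by
  have polarized := h.polar_mul_left (x + z) y w
  simp only [add_mul, polar_add_left, polar_add_right, h.polar_mul_left, QuadraticMap.map_add n x z,
    polar_comm n (z * y)] at polarized
  linear_combination polarized

theorem bar_bar (h : IsHurwitz n) (x : A) : bar n (bar n x) = x := by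
  have trace_bar : polar n (bar n x) 1 = polar n x 1 := by
    rw [bar_apply, polar_sub_left, polar_smul_left, h.polar_one_one, smul_eq_mul]
    ring
  rw [bar_apply, trace_bar, bar_apply, sub_sub_cancel]

theorem norm_ne_zero_of_mul_eq_one (h : IsHurwitz n) {a b : A} (hab : a * b = 1) :
    n a ≠ 0 ∧ n b ≠ 0 := by
  rw [← mul_ne_zero_iff, ← h.map_mul, hab, h.map_one]
  exact one_ne_zero

section ScalarTower

variable [IsScalarTower k A A]

theorem polar_mul_eq_bar_mul (h : IsHurwitz n) (x y z : A) :
    polar n (x * y) z = polar n y (bar n x * z) := by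
  have exchange := h.polar_mul_mul x y 1 z
  simp only [one_mul] at exchange
  rw [bar_apply, sub_mul, smul_one_mul, polar_sub_right, polar_smul_right, smul_eq_mul,
    polar_comm n y (x * z)]
  linear_combination exchange

theorem bar_mul_mul (h : IsHurwitz n) (x y : A) : bar n x * (x * y) = n x • y :=
  h.nonDegenerate.ext fun z => by
    rw [h.polar_mul_eq_bar_mul, h.bar_bar, h.polar_mul_left, polar_smul_left, smul_eq_mul]

theorem bar_mul_self (h : IsHurwitz n) (x : A) : bar n x * x = n x • (1 : A) := by
  simpa only [mul_one] using h.bar_mul_mul x 1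

theorem mul_self (h : IsHurwitz n) (x : A) : x * x = polar n x 1 • x - n x • (1 : A) := by
  rw [← h.bar_mul_self x, bar_apply, sub_mul, smul_one_mul, sub_sub_cancel]

theorem mul_add_mul (h : IsHurwitz n) (x y : A) :
    x * y + y * x = polar n x 1 • y + polar n y 1 • x - polar n x y • (1 : A) := by
  have polarized := h.mul_self (x + y)
  simp only [mul_add, add_mul, h.mul_self x, h.mul_self y, QuadraticMap.map_add n x y,
    polar_add_left] at polarized
  linear_combination (norm := module) polarized

theorem bar_mul_mul_add (h : IsHurwitz n) (x z y : A) :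
    bar n x * (z * y) + bar n z * (x * y) = polar n x z • y := by
  have polarized := h.bar_mul_mul (x + z) y
  simp only [_root_.map_add, mul_add, add_mul, h.bar_mul_mul,
    QuadraticMap.map_add n x z] at polarized
  linear_combination (norm := module) polarized

theorem inverse_mul_cancel_left (h : IsHurwitz n) {a : A} (ha : n a ≠ 0) (x : A) :
    inverse n a * (a * x) = x := by
  rw [inverse, smul_mul_assoc, h.bar_mul_mul, inv_smul_smul₀ ha]

theorem norm_unique {n' : QuadraticForm k A} (h : IsHurwitz n) (h' : IsHurwitz n') (x : A) :
    n x = n' x := by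
  have h_sq := h.mul_self x
  rw [h'.mul_self x] at h_sq
  by_cases ht : polar n x 1 = polar n' x 1
  · rw [ht, sub_right_inj] at h_sq
    exact (h.smul_one_injective h_sq).symm
  · have scalar : x = ((polar n x 1 - polar n' x 1)⁻¹ * (n x - n' x)) • (1 : A) := by
      rw [mul_smul, eq_inv_smul_iff₀ (sub_ne_zero.mpr ht)]
      linear_combination (norm := module) -h_sq
    rw [scalar, h.map_smul_one, h'.map_smul_one]

theorem mul_mul_left (h : IsHurwitz n) (x y : A) : x * (x * y) = (x * x) * y := by
  rw [h.mul_self, sub_mul, smul_mul_assoc, smul_one_mul, ← h.bar_mul_mul, bar_apply, sub_mul,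
    smul_one_mul, sub_sub_cancel]

theorem associator_swap_left (h : IsHurwitz n) (x y z : A) :
    (x * y) * z - x * (y * z) = -((y * x) * z - y * (x * z)) := by
  have polarized := h.mul_mul_left (x + y) z
  simp only [add_mul, mul_add, h.mul_mul_left x z, h.mul_mul_left y z] at polarized
  linear_combination (norm := module) -polarized

end ScalarTower

section SMulComm

variable [SMulCommClass k A A]

theorem polar_mul_eq_mul_bar (h : IsHurwitz n) (x y z : A) :
    polar n (x * y) z = polar n x (z * bar n y) := by
  have exchange := h.polar_mul_mul x y z 1
  simp only [mul_one] at exchange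
  rw [bar_apply, mul_sub, mul_smul_one, polar_sub_right, polar_smul_right, smul_eq_mul]
  linear_combination exchange

theorem mul_mul_bar (h : IsHurwitz n) (x y : A) : (y * x) * bar n x = n x • y :=
  h.nonDegenerate.ext fun z => by
    rw [h.polar_mul_eq_mul_bar, h.bar_bar, h.polar_mul_right, polar_smul_left, smul_eq_mul,
      mul_comm]

theorem mul_bar_self (h : IsHurwitz n) (x : A) : x * bar n x = n x • (1 : A) := by
  simpa only [one_mul] using h.mul_mul_bar x 1

theorem mul_mul_self (h : IsHurwitz n) (a x : A) :
    (a * x) * a = polar n a (bar n x) • a - n a • bar n x := by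
  refine h.nonDegenerate.ext fun z => ?_
  have exchange := h.polar_mul_mul a x z (bar n a)
  rw [h.mul_bar_self, polar_smul_left, polar_comm n 1, h.polar_mul_eq_mul_bar z, one_mul]
    at exchange
  rw [h.polar_mul_eq_mul_bar, polar_sub_left, polar_smul_left, polar_smul_left,
    polar_comm n a (bar n x), polar_bar_left, polar_comm n (bar n x)]
  simp only [smul_eq_mul] at exchange ⊢
  linear_combination exchange

theorem mul_inverse_cancel_right (h : IsHurwitz n) {a : A} (ha : n a ≠ 0) (x : A) :
    (x * a) * inverse n a = x := by
  rw [inverse, mul_smul_comm, h.mul_mul_bar, inv_smul_smul₀ ha]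

theorem mul_inverse (h : IsHurwitz n) {a : A} (ha : n a ≠ 0) : a * inverse n a = 1 := by
  simpa only [one_mul] using h.mul_inverse_cancel_right ha 1

theorem eq_inverse_of_mul_eq_one (h : IsHurwitz n) {a b : A} (hab : a * b = 1) :
    a = inverse n b := by
  simpa only [hab, one_mul] using
    (h.mul_inverse_cancel_right (h.norm_ne_zero_of_mul_eq_one hab).2 a).symm

end SMulComm

end IsHurwitz

variable [SMulCommClass k A A] [IsScalarTower k A A]

namespace IsHurwitz

theorem map_bar (h : IsHurwitz n) (x : A) : n (bar n x) = n x := by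
  refine h.smul_one_injective ?_
  simp only [← h.mul_bar_self (bar n x), h.bar_bar, h.bar_mul_self]

theorem mul_bar_mul (h : IsHurwitz n) (x y : A) : x * (bar n x * y) = n x • y := by
  simpa only [h.bar_bar, h.map_bar] using h.bar_mul_mul (bar n x) y

theorem mul_bar_mul' (h : IsHurwitz n) (x y : A) : (y * bar n x) * x = n x • y := by
  simpa only [h.bar_bar, h.map_bar] using h.mul_mul_bar (bar n x) y

theorem bar_mul (h : IsHurwitz n) (x y : A) : bar n (x * y) = bar n y * bar n x :=
  h.nonDegenerate.ext fun z => by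
    rw [polar_bar_left, h.polar_mul_eq_bar_mul, h.polar_mul_eq_bar_mul, h.bar_bar,
      polar_comm n (bar n x), h.polar_mul_eq_mul_bar]

theorem mul_mul_right (h : IsHurwitz n) (x y : A) : (y * x) * x = y * (x * x) := by
  rw [h.mul_self, mul_sub, mul_smul_comm, mul_smul_one, ← h.mul_mul_bar, bar_apply, mul_sub,
    mul_smul_one, sub_sub_cancel]

theorem left_moufang (h : IsHurwitz n) (a x y : A) : a * (x * (a * y)) = ((a * x) * a) * y := by
  have polarized := h.bar_mul_mul_add (bar n x) a y
  rw [h.bar_bar] at polarized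
  rw [h.mul_mul_self, eq_sub_of_add_eq polarized, mul_sub, h.mul_bar_mul, sub_mul, mul_smul_comm,
    smul_mul_assoc, smul_mul_assoc, polar_comm n a]

theorem middle_moufang (h : IsHurwitz n) (a x y : A) : (a * x) * (y * a) = (a * (x * y)) * a := by
  refine h.nonDegenerate.ext fun z => ?_
  have exchange := h.polar_mul_mul y a (bar n x * bar n a) z
  rw [h.mul_bar_mul', polar_smul_right, h.polar_mul_eq_mul_bar y z, ← h.polar_mul_eq_bar_mul,
    ← polar_bar_left, ← h.polar_mul_eq_bar_mul, ← polar_bar_left] at exchange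
  rw [h.polar_mul_eq_bar_mul (a * x), h.bar_mul, h.mul_mul_self, polar_sub_left, polar_smul_left,
    polar_smul_left, polar_comm n a (bar n (x * y))]
  simp only [smul_eq_mul] at exchange ⊢
  linear_combination exchange

/-! ### Inverses and the nucleus -/

theorem associator_swap_right (h : IsHurwitz n) (x y z : A) :
    (x * y) * z - x * (y * z) = -((x * z) * y - x * (z * y)) := by
  have polarized := h.mul_mul_right (y + z) x
  simp only [add_mul, mul_add, h.mul_mul_right y x, h.mul_mul_right z x] at polarized
  linear_combination (norm := module) polarized

theorem mem_nucleus_of_middle (h : IsHurwitz n) {w : A} (hw : ∀ x y, (x * w) * y = x * (w * y)) :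
    w ∈ nucleus A := by
  intro x y
  refine ⟨?_, hw x y, ?_⟩
  · rw [← sub_eq_zero, h.associator_swap_left, hw, sub_self, neg_zero]
  · rw [← sub_eq_zero, h.associator_swap_right, hw, sub_self, neg_zero]

theorem mul_inverse_cancel_left (h : IsHurwitz n) {a : A} (ha : n a ≠ 0) (x : A) :
    a * (inverse n a * x) = x := by
  rw [inverse, smul_mul_assoc, mul_smul_comm, h.mul_bar_mul, inv_smul_smul₀ ha]

theorem inverse_mul_cancel_right (h : IsHurwitz n) {a : A} (ha : n a ≠ 0) (x : A) :
    (x * inverse n a) * a = x := by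
  rw [inverse, mul_smul_comm, smul_mul_assoc, h.mul_bar_mul', inv_smul_smul₀ ha]

/-- Multiplication by `a` on the left, for `a` of non-zero norm. -/
def leftEquiv (h : IsHurwitz n) {a : A} (ha : n a ≠ 0) : A ≃ₗ[k] A :=
  LinearEquiv.ofLinearMap (LinearMap.mulLeft k a) (LinearMap.mulLeft k (inverse n a))
    (LinearMap.ext (h.mul_inverse_cancel_left ha)) (LinearMap.ext (h.inverse_mul_cancel_left ha))

theorem leftEquiv_apply (h : IsHurwitz n) {a : A} (ha : n a ≠ 0) (x : A) :
    h.leftEquiv ha x = a * x := rfl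

/-- Multiplication by `a` on the right, for `a` of non-zero norm. -/
def rightEquiv (h : IsHurwitz n) {a : A} (ha : n a ≠ 0) : A ≃ₗ[k] A :=
  LinearEquiv.ofLinearMap (LinearMap.mulRight k a) (LinearMap.mulRight k (inverse n a))
    (LinearMap.ext (h.inverse_mul_cancel_right ha)) (LinearMap.ext (h.mul_inverse_cancel_right ha))

theorem exists_nucleus_unit (h : IsHurwitz n) {f g : A → A} (hfg : ∀ x y, f x * g y = x * y) :
    ∃ w : (nucleus A)ˣ, ∀ x, f x * (w : nucleus A) = x ∧ g x = (w : nucleus A) * x := by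
  set a := f 1 with ha
  set b := g 1 with hb
  have hab : a * b = 1 := by rw [ha, hb, hfg, one_mul]
  have hb0 : n b ≠ 0 := (h.norm_ne_zero_of_mul_eq_one hab).2
  have a_eq : a = inverse n b := h.eq_inverse_of_mul_eq_one hab
  have f_mul_b : ∀ x, f x * b = x := fun x => by rw [hfg, mul_one]
  have g_eq : ∀ y, g y = b * y := fun y => by
    rw [← h.mul_inverse_cancel_left hb0 (g y), ← a_eq, hfg, one_mul]
  have f_eq : ∀ x, f x = x * a := fun x => by
    rw [← h.mul_inverse_cancel_right hb0 (f x), f_mul_b, a_eq]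
  have b_mem : b ∈ nucleus A := h.mem_nucleus_of_middle fun x y => by
    rw [← hfg, g_eq, f_eq, a_eq, h.mul_inverse_cancel_right hb0]
  have a_mem : a ∈ nucleus A := h.mem_nucleus_of_middle fun x y => by
    rw [← hfg x (a * y), g_eq, f_eq, a_eq, h.mul_inverse_cancel_left hb0]
  refine ⟨⟨⟨b, b_mem⟩, ⟨a, a_mem⟩, Subtype.ext ?_, Subtype.ext hab⟩,
    fun x => ⟨f_mul_b x, g_eq x⟩⟩
  exact (congrArg (b * ·) a_eq).trans (h.mul_inverse hb0)

end IsHurwitz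

end Identities

/-! ### Isometries as products of reflections -/

section Reflections

variable {k V : Type*} [Field k] [AddCommGroup V] [Module k V] {q : QuadraticForm k V}

theorem HasMultiplier.polar_apply {φ : V ≃ₗ[k] V} {m : kˣ} (h : HasMultiplier q φ m) (x y : V) :
    polar q (φ x) (φ y) = m * polar q x y := by
  simp only [polar, ← map_add, h x, h y, h (x + y)]
  ring

theorem inv_smul_polarBilin_self {a : V} (ha : q a ≠ 0) :
    ((q a)⁻¹ • q.polarBilin a) a = (2 : k) := by
  rw [LinearMap.smul_apply, polarBilin_apply_apply, polar_self, smul_eq_mul, nsmul_eq_mul,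
    Nat.cast_ofNat, mul_left_comm, inv_mul_cancel₀ ha, mul_one]

/-- The reflection `x ↦ x - q(a)⁻¹ ⟨x, a⟩ a` in a non-singular vector `a`. -/
noncomputable def reflection (q : QuadraticForm k V) (a : V) (ha : q a ≠ 0) : V ≃ₗ[k] V :=
  Module.reflection (inv_smul_polarBilin_self ha)

theorem reflection_apply {a : V} (ha : q a ≠ 0) (x : V) :
    reflection q a ha x = x - ((q a)⁻¹ * polar q x a) • a := by
  rw [reflection, Module.reflection_apply, polar_comm]
  rfl

theorem reflection_mul_self {a : V} (ha : q a ≠ 0) : reflection q a ha * reflection q a ha = 1 :=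
  LinearEquiv.ext (Module.involutive_reflection (inv_smul_polarBilin_self ha))

theorem reflection_inv {a : V} (ha : q a ≠ 0) : (reflection q a ha)⁻¹ = reflection q a ha :=
  inv_eq_of_mul_eq_one_left (reflection_mul_self ha)

theorem map_sub_eq (x y : V) : q (x - y) = q x - polar q x y + q y := by
  rw [sub_eq_add_neg, QuadraticMap.map_add q, QuadraticMap.map_neg, polar_neg_right]
  ring

theorem hasMultiplier_reflection {a : V} (ha : q a ≠ 0) :
    HasMultiplier q (reflection q a ha) 1 := fun x => by
  rw [reflection_apply, map_sub_eq, polar_smul_right, QuadraticMap.map_smul, smul_eq_mul,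
    smul_eq_mul, Units.val_one]
  field_simp
  ring

/-- The group generated by the reflections of a quadratic space. -/
def reflectionGroup (q : QuadraticForm k V) : Subgroup (V ≃ₗ[k] V) :=
  Subgroup.closure {s | ∃ (a : V) (ha : q a ≠ 0), s = reflection q a ha}

theorem reflection_mem {a : V} (ha : q a ≠ 0) : reflection q a ha ∈ reflectionGroup q :=
  Subgroup.subset_closure ⟨a, ha, rfl⟩

theorem hasMultiplier_of_mem_reflectionGroup {φ : V ≃ₗ[k] V} (hφ : φ ∈ reflectionGroup q) :
    HasMultiplier q φ 1 := by
  induction hφ using Subgroup.closure_induction with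
  | mem x hx =>
    obtain ⟨a, ha, rfl⟩ := hx
    exact hasMultiplier_reflection ha
  | one => exact HasMultiplier.one q
  | mul x y _ _ hx hy => simpa only [mul_one] using hx.mul hy
  | inv x _ hx => simpa only [inv_one] using hx.inv

-- The product of the reflections in `p` and in `p + c q(p) x`.
theorem exists_mem_reflectionGroup_eq_add_polar_nonsingular {p x : V} (hp : q p ≠ 0)
    (hx : q x = 0) (hpx : polar q p x = 0) (c : k) :
    ∃ g ∈ reflectionGroup q, ∀ z, polar q z x = 0 → g z = z + (c * polar q z p) • x := by
  have norm_eq : q (p + (c * q p) • x) = q p := by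
    rw [QuadraticMap.map_add q, QuadraticMap.map_smul, hx, polar_smul_right, hpx, smul_zero,
      smul_zero, add_zero, add_zero]
  have norm_ne : q (p + (c * q p) • x) ≠ 0 := by rwa [norm_eq]
  refine ⟨reflection q _ norm_ne * reflection q p hp,
    mul_mem (reflection_mem norm_ne) (reflection_mem hp), fun z hz => ?_⟩
  have coeff : (q p)⁻¹ * (polar q z p - (q p)⁻¹ * polar q z p * (2 * q p)) =
      -((q p)⁻¹ * polar q z p) := by
    field_simp
    ring
  rw [LinearEquiv.mul_apply, reflection_apply hp, reflection_apply norm_ne, norm_eq,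
    polar_sub_left, polar_smul_left, polar_add_right, polar_add_right, polar_smul_right,
    polar_smul_right, hz, hpx, polar_self]
  simp only [smul_eq_mul, nsmul_eq_mul, Nat.cast_ofNat, mul_zero, add_zero, coeff]
  match_scalars <;> field_simp
  ring

theorem exists_mem_reflectionGroup_eq_add_polar_singular {w x y : V} (hw : q w ≠ 0) (hx : q x = 0)
    (hy : q y = 0) (hwx : polar q w x = 0) (hwy : polar q w y = 0) (hxy : polar q x y = 0)
    (c : k) : ∃ g ∈ reflectionGroup q, ∀ z, polar q z x = 0 → g z = z + (c * polar q z y) • x := by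
  have norm_ne : q (w + y) ≠ 0 := by
    rwa [QuadraticMap.map_add q, hy, hwy, add_zero, add_zero]
  have orthogonal : polar q (w + y) x = 0 := by
    rw [polar_add_left, hwx, polar_comm, hxy, add_zero]
  obtain ⟨g, hg, g_eq⟩ := exists_mem_reflectionGroup_eq_add_polar_nonsingular hw hx hwx (-c)
  obtain ⟨g', hg', g'_eq⟩ :=
    exists_mem_reflectionGroup_eq_add_polar_nonsingular norm_ne hx orthogonal c
  refine ⟨g' * g, mul_mem hg' hg, fun z hz => ?_⟩
  have xx : polar q x x = 0 := by rw [polar_self, hx, smul_zero]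
  have gz : polar q (z + (-c * polar q z w) • x) x = 0 := by
    rw [polar_add_left, polar_smul_left, hz, xx, smul_zero, add_zero]
  rw [LinearEquiv.mul_apply, g_eq z hz, g'_eq _ gz, polar_add_left, polar_smul_left,
    polar_add_right, polar_add_right, polar_comm q x w, hwx, hxy]
  module

/-- The space of vectors fixed by `φ`. -/
def fixedSpace (φ : V ≃ₗ[k] V) : Submodule k V := LinearMap.eqLocus (φ : V →ₗ[k] V) LinearMap.id

theorem mem_fixedSpace {φ : V ≃ₗ[k] V} {x : V} : x ∈ fixedSpace φ ↔ φ x = x := Iff.rfl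

theorem fixedSpace_lt {φ g : V ≃ₗ[k] V} (hg : ∀ x ∈ fixedSpace φ, g x = x) {v : V} (hv : φ v ≠ v)
    (hgv : g (φ v) = v) : fixedSpace φ < fixedSpace (g * φ) := by
  refine lt_of_le_of_ne (fun x hx => ?_) fun heq => hv ?_
  · rw [mem_fixedSpace, LinearEquiv.mul_apply, mem_fixedSpace.mp hx, hg x hx]
  · rwa [← mem_fixedSpace, heq]

section Isometry

variable {φ : V ≃ₗ[k] V} (hφ : HasMultiplier q φ 1)
include hφ

theorem polar_apply_sub_of_mem_fixedSpace {x : V} (hx : x ∈ fixedSpace φ) (u : V) :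
    polar q x (φ u - u) = 0 := by
  have invariance := hφ.polar_apply x u
  rwa [mem_fixedSpace.mp hx, Units.val_one, one_mul, ← sub_eq_zero, ← polar_sub_right]
    at invariance

theorem polar_apply_apply_sub (v : V) : polar q (φ v) (φ v - v) = q (φ v - v) := by
  have norm_eq := hφ v
  rw [← sub_sub_cancel (φ v) v, map_sub_eq, sub_sub_cancel, Units.val_one, one_mul] at norm_eq
  linear_combination norm_eq

theorem fixedSpace_lt_reflection_mul {v : V} (hv : q (φ v - v) ≠ 0) :
    fixedSpace φ < fixedSpace (reflection q _ hv * φ) := by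
  refine fixedSpace_lt (v := v) (fun x hx => ?_) (fun h => hv ?_) ?_
  · rw [reflection_apply, polar_apply_sub_of_mem_fixedSpace hφ hx, mul_zero, zero_smul, sub_zero]
  · rw [h, sub_self, QuadraticMap.map_zero]
  · rw [reflection_apply, polar_apply_apply_sub hφ, inv_mul_cancel₀ hv, one_smul, sub_sub_cancel]

theorem exists_mem_reflectionGroup_fixedSpace_lt_of_singular (hq : NonDegenerate q) {w : V}
    (hw : q w ≠ 0) (hφw : w ∈ fixedSpace φ) (hne : φ ≠ 1) (hsing : ∀ v, q (φ v - v) = 0) :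
    ∃ g ∈ reflectionGroup q, fixedSpace φ < fixedSpace (g * φ) := by
  obtain ⟨u, hu⟩ : ∃ u, φ u ≠ u := not_forall.mp fun h => hne (LinearEquiv.ext h)
  obtain ⟨v, hv⟩ : ∃ v, polar q v (φ u - u) ≠ 0 := not_forall.mp fun h =>
    hu (sub_eq_zero.mp (hq _ fun v => (polar_comm q _ v).trans (h v)))
  have displacements_orthogonal : ∀ a b, polar q (φ a - a) (φ b - b) = 0 := fun a b => by
    have sum_eq : φ a - a + (φ b - b) = φ (a + b) - (a + b) := by
      rw [map_add]
      abel
    rw [polar, sum_eq, hsing, hsing, hsing, sub_zero, sub_zero]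
  have hw_perp := polar_apply_sub_of_mem_fixedSpace hφ hφw
  obtain ⟨g, hg, g_eq⟩ := exists_mem_reflectionGroup_eq_add_polar_singular hw (hsing v) (hsing u)
    (hw_perp v) (hw_perp u) (displacements_orthogonal v u) (-(polar q v (φ u - u))⁻¹)
  refine ⟨g, hg, fixedSpace_lt (v := v) (fun x hx => ?_) (fun h => hv ?_) ?_⟩
  · rw [g_eq x (polar_apply_sub_of_mem_fixedSpace hφ hx v),
      polar_apply_sub_of_mem_fixedSpace hφ hx, mul_zero, zero_smul, add_zero]
  · exact polar_apply_sub_of_mem_fixedSpace hφ h u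
  · have pairing : polar q (φ v) (φ u - u) = polar q v (φ u - u) := by
      rw [← sub_eq_zero, ← polar_sub_left, displacements_orthogonal]
    rw [g_eq _ ((polar_apply_apply_sub hφ v).trans (hsing v)), pairing, neg_mul,
      inv_mul_cancel₀ hv, neg_one_smul, ← sub_eq_add_neg, sub_sub_cancel]

theorem mem_reflectionGroup [FiniteDimensional k V] (hq : NonDegenerate q) {w : V} (hw : q w ≠ 0)
    (hφw : w ∈ fixedSpace φ) : φ ∈ reflectionGroup q := by
  induction hF : fixedSpace φ using WellFoundedGT.induction generalizing φ with
  | ind F ih =>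
    subst hF
    by_cases hne : φ = 1
    · exact hne ▸ one_mem _
    obtain ⟨g, hg, hlt⟩ : ∃ g ∈ reflectionGroup q, fixedSpace φ < fixedSpace (g * φ) := by
      by_cases hsing : ∀ v, q (φ v - v) = 0
      · exact exists_mem_reflectionGroup_fixedSpace_lt_of_singular hφ hq hw hφw hne hsing
      · obtain ⟨v, hv⟩ := not_forall.mp hsing
        exact ⟨_, reflection_mem hv, fixedSpace_lt_reflection_mul hφ hv⟩
    refine (mul_mem_cancel_left hg).mp (ih _ hlt ?_ (hlt.le hφw) rfl)
    simpa only [mul_one] using (hasMultiplier_of_mem_reflectionGroup hg).mul hφ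

end Isometry

end Reflections

/-! ### Autotopies -/

section Autotopy

variable (k A : Type*) [Field k] [NonAssocRing A] [Module k A]

/-- The group of linear automorphisms `φ` that are a component of an autotopy: there are linear
automorphisms `φ₁`, `φ₂` with `φ (x y) = φ₁ x φ₂ y`. Nothing is assumed about norms, although for a
Hurwitz algebra all three maps turn out to be similitudes. -/
def autotopyGroup : Subgroup (A ≃ₗ[k] A) where
  carrier := {φ | ∃ φ₁ φ₂ : A ≃ₗ[k] A, ∀ x y, φ (x * y) = φ₁ x * φ₂ y}
  mul_mem' := by
    rintro φ ψ ⟨φ₁, φ₂, hφ⟩ ⟨ψ₁, ψ₂, hψ⟩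
    exact ⟨φ₁ * ψ₁, φ₂ * ψ₂, fun x y => by simp only [LinearEquiv.mul_apply, hψ, hφ]⟩
  one_mem' := ⟨1, 1, fun _ _ => rfl⟩
  inv_mem' := by
    rintro φ ⟨φ₁, φ₂, hφ⟩
    exact ⟨φ₁.symm, φ₂.symm, fun x y => φ.symm_apply_eq.mpr <| by
      rw [hφ, LinearEquiv.apply_symm_apply, LinearEquiv.apply_symm_apply]⟩

variable {k A} {n : QuadraticForm k A}

theorem mem_GO_of_ne_zero {φ : A ≃ₗ[k] A} {c : k} (hc : c ≠ 0) (hφ : ∀ x, n (φ x) = c * n x) :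
    φ ∈ GO n :=
  ⟨Units.mk0 c hc, hφ⟩

section Components

variable {φ φ₁ φ₂ : A ≃ₗ[k] A} (h : IsHurwitz n) (hφ : ∀ x y, φ (x * y) = φ₁ x * φ₂ y)
include h hφ

theorem IsHurwitz.norm_autotopy (x y : A) : n (φ (x * y)) = n (φ₁ x) * n (φ₂ y) := by
  rw [hφ, h.map_mul]

theorem IsHurwitz.norm_autotopy_left (x : A) : n (φ x) = n (φ₁ x) * n (φ₂ 1) := by
  simpa only [mul_one] using h.norm_autotopy hφ x 1

theorem IsHurwitz.norm_autotopy_right (x : A) : n (φ x) = n (φ₁ 1) * n (φ₂ x) := by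
  simpa only [one_mul] using h.norm_autotopy hφ 1 x

theorem IsHurwitz.norm_autotopy_one_ne_zero : n (φ₁ 1) ≠ 0 ∧ n (φ₂ 1) ≠ 0 := by
  have norm_ne : n (φ (φ.symm 1)) ≠ 0 := by
    rw [LinearEquiv.apply_symm_apply, h.map_one]
    exact one_ne_zero
  constructor
  · rw [h.norm_autotopy_right hφ] at norm_ne
    exact left_ne_zero_of_mul norm_ne
  · rw [h.norm_autotopy_left hφ] at norm_ne
    exact right_ne_zero_of_mul norm_ne

theorem IsHurwitz.norm_apply_one_ne_zero : n (φ 1) ≠ 0 := by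
  rw [h.norm_autotopy_left hφ]
  exact mul_ne_zero_iff.mpr (h.norm_autotopy_one_ne_zero hφ)

theorem IsHurwitz.isHurwitz_comp_autotopy :
    IsHurwitz ((n (φ 1))⁻¹ • n.comp (φ : A →ₗ[k] A)) where
  nontrivial := h.nontrivial
  nonDegenerate x hx := by
    refine φ.map_eq_zero_iff.mp <| h.nonDegenerate _ fun y => ?_
    have pairing := hx (φ.symm y)
    rw [FunLike.coe_smul, polar_smul] at pairing
    simpa only [polar, QuadraticMap.comp_apply, LinearEquiv.coe_coe, map_add,
      LinearEquiv.apply_symm_apply] using (smul_eq_zero.mp pairing).resolve_left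
      (inv_ne_zero (h.norm_apply_one_ne_zero hφ))
  map_mul x y := by
    obtain ⟨h₁, h₂⟩ := h.norm_autotopy_one_ne_zero hφ
    simp only [smul_apply, QuadraticMap.comp_apply, LinearEquiv.coe_coe, smul_eq_mul]
    rw [h.norm_autotopy hφ, h.norm_autotopy_left hφ x, h.norm_autotopy_right hφ y,
      h.norm_autotopy_left hφ 1]
    field_simp

variable [IsScalarTower k A A]

-- The norm of `A`, transported along `φ` and rescaled, is again a Hurwitz norm on `A`.
theorem IsHurwitz.norm_apply_eq (x : A) : n (φ x) = n (φ 1) * n x := by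
  rw [h.norm_unique (h.isHurwitz_comp_autotopy hφ) x, smul_apply, smul_eq_mul,
    mul_inv_cancel_left₀ (h.norm_apply_one_ne_zero hφ)]
  rfl

theorem IsHurwitz.mem_GO_of_autotopy : φ ∈ GO n :=
  mem_GO_of_ne_zero (h.norm_apply_one_ne_zero hφ) (h.norm_apply_eq hφ)

theorem IsHurwitz.isTriality_of_autotopy : IsTriality n φ φ₁ φ₂ := by
  obtain ⟨h₁, h₂⟩ := h.norm_autotopy_one_ne_zero hφ
  refine ⟨mem_GO_of_ne_zero h₁ fun x => mul_right_cancel₀ h₂ ?_,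
    mem_GO_of_ne_zero h₂ fun x => mul_left_cancel₀ h₁ ?_, hφ⟩
  · rw [← h.norm_autotopy_left hφ, h.norm_apply_eq hφ, h.norm_autotopy_left hφ 1, mul_right_comm]
  · rw [← h.norm_autotopy_right hφ, h.norm_apply_eq hφ, h.norm_autotopy_left hφ 1, mul_assoc]

end Components

theorem IsHurwitz.autotopyGroup_le_GO [IsScalarTower k A A] (h : IsHurwitz n) :
    autotopyGroup k A ≤ GO n := by
  rintro φ ⟨φ₁, φ₂, hφ⟩
  exact h.mem_GO_of_autotopy hφ

namespace IsHurwitz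

theorem map_one_ne_zero (h : IsHurwitz n) : n 1 ≠ 0 := by
  rw [h.map_one]
  exact one_ne_zero

theorem reflection_one_apply (h : IsHurwitz n) (x : A) :
    reflection n 1 h.map_one_ne_zero x = -bar n x := by
  rw [reflection_apply, h.map_one, inv_one, one_mul, bar_apply, neg_sub]

variable [SMulCommClass k A A]

theorem reflection_mul_reflection_one_apply (h : IsHurwitz n) {a : A} (ha : n a ≠ 0) (x : A) :
    (reflection n a ha * reflection n 1 h.map_one_ne_zero) x = (n a)⁻¹ • ((a * x) * a) := by
  rw [LinearEquiv.mul_apply, h.reflection_one_apply, reflection_apply, h.mul_mul_self,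
    smul_sub, inv_smul_smul₀ ha, polar_neg_left, polar_comm n a]
  module

variable [IsScalarTower k A A]

theorem leftEquiv_mem_autotopyGroup (h : IsHurwitz n) {a : A} (ha : n a ≠ 0) :
    h.leftEquiv ha ∈ autotopyGroup k A := by
  refine ⟨h.rightEquiv ha * h.leftEquiv ha, (h.leftEquiv ha).symm, fun x y => ?_⟩
  have moufang := h.left_moufang a x ((h.leftEquiv ha).symm y)
  rwa [← h.leftEquiv_apply ha ((h.leftEquiv ha).symm y), LinearEquiv.apply_symm_apply] at moufang

theorem reflection_mul_reflection_one_mem_autotopyGroup (h : IsHurwitz n) {a : A} (ha : n a ≠ 0) :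
    reflection n a ha * reflection n 1 h.map_one_ne_zero ∈ autotopyGroup k A := by
  refine ⟨h.leftEquiv ha, LinearEquiv.smulOfNeZero k A _ (inv_ne_zero ha) * h.rightEquiv ha,
    fun x y => ?_⟩
  rw [h.reflection_mul_reflection_one_apply, ← h.middle_moufang, ← mul_smul_comm]
  rfl

theorem reflection_mul_reflection_mem_autotopyGroup (h : IsHurwitz n) {a b : A} (ha : n a ≠ 0)
    (hb : n b ≠ 0) : reflection n a ha * reflection n b hb ∈ autotopyGroup k A := by
  have quotient := div_mem (h.reflection_mul_reflection_one_mem_autotopyGroup ha)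
    (h.reflection_mul_reflection_one_mem_autotopyGroup hb)
  rwa [mul_div_mul_right_eq_div, div_eq_mul_inv, reflection_inv] at quotient

end IsHurwitz

end Autotopy

/-! ### Index-two subgroups of the similitude group -/

section Parity

variable {k V A : Type*} [Field k] [AddCommGroup V] [Module k V] [NonAssocRing A] [Module k A]

theorem mem_or_mul_reflection_mem {q : QuadraticForm k V} {H : Subgroup (V ≃ₗ[k] V)}
    (hH : ∀ a b (ha : q a ≠ 0) (hb : q b ≠ 0), reflection q a ha * reflection q b hb ∈ H)
    {φ : V ≃ₗ[k] V} (hφ : φ ∈ reflectionGroup q) {c : V} (hc : q c ≠ 0) :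
    φ ∈ H ∨ φ * reflection q c hc ∈ H := by
  have step : ∀ ψ, ∀ a (ha : q a ≠ 0), ψ ∈ H ∨ ψ * reflection q c hc ∈ H →
      ψ * reflection q a ha ∈ H ∨ ψ * reflection q a ha * reflection q c hc ∈ H := by
    rintro ψ a ha (hψ | hψ)
    · exact .inr <| mul_assoc ψ _ _ ▸ mul_mem hψ (hH a c ha hc)
    · refine .inl ?_
      have product := mul_mem hψ (hH c a hc ha)
      rwa [mul_assoc, ← mul_assoc (reflection q c hc), reflection_mul_self, one_mul] at product
  induction hφ using Subgroup.closure_induction_right with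
  | one => exact .inl (one_mem H)
  | mul_right ψ _ s hs ih =>
    obtain ⟨a, ha, rfl⟩ := hs
    exact step ψ a ha ih
  | mul_inv_cancel ψ _ s hs ih =>
    obtain ⟨a, ha, rfl⟩ := hs
    rw [reflection_inv]
    exact step ψ a ha ih

variable {n : QuadraticForm k A}

theorem finrank_span_pair_le (x y : V) : Module.finrank k (Submodule.span k {x, y}) ≤ 2 := by
  classical
  exact (finrank_span_le_card {x, y}).trans (by simpa using Finset.card_le_two)

theorem IsHurwitz.exists_polar_one_eq_one (h : IsHurwitz n) : ∃ u, polar n u 1 = 1 := by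
  have := h.nontrivial
  obtain ⟨v, hv⟩ : ∃ v, polar n 1 v ≠ 0 :=
    not_forall.mp fun hall => one_ne_zero (h.nonDegenerate 1 hall)
  exact ⟨(polar n 1 v)⁻¹ • v, by
    rw [polar_smul_left, polar_comm n v, smul_eq_mul, inv_mul_cancel₀ hv]⟩

variable [SMulCommClass k A A] [IsScalarTower k A A]

theorem IsHurwitz.mem_or_mul_reflection_one_mem [FiniteDimensional k A] (h : IsHurwitz n)
    {H : Subgroup (A ≃ₗ[k] A)} (hleft : ∀ a (ha : n a ≠ 0), h.leftEquiv ha ∈ H)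
    (hrefl : ∀ a b (ha : n a ≠ 0) (hb : n b ≠ 0), reflection n a ha * reflection n b hb ∈ H)
    {φ : A ≃ₗ[k] A} (hφ : φ ∈ GO n) :
    φ ∈ H ∨ φ * reflection n 1 h.map_one_ne_zero ∈ H := by
  obtain ⟨m, hm⟩ := hφ
  have norm_image : n (φ 1) = m := by rw [hm, h.map_one, mul_one]
  have ha : n (φ 1) ≠ 0 := norm_image ▸ m.ne_zero
  set ψ := (h.leftEquiv ha)⁻¹ * φ with hψ
  have mul_ψ : ∀ x, φ 1 * ψ x = φ x := fun x => (h.leftEquiv ha).apply_symm_apply (φ x)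
  have isometry : HasMultiplier n ψ 1 := fun x => mul_left_cancel₀ ha <| by
    rw [← h.map_mul, mul_ψ, hm, norm_image, Units.val_one, one_mul]
  have fixes_one : ψ 1 = 1 := (h.leftEquiv ha).injective <| by
    rw [h.leftEquiv_apply, h.leftEquiv_apply, mul_ψ, mul_one]
  have φ_eq : φ = h.leftEquiv ha * ψ := by rw [hψ, mul_inv_cancel_left]
  rw [φ_eq, mul_assoc, mul_mem_cancel_left (hleft _ ha), mul_mem_cancel_left (hleft _ ha)]
  exact mem_or_mul_reflection_mem hrefl
    (mem_reflectionGroup isometry h.nonDegenerate h.map_one_ne_zero fixes_one) h.map_one_ne_zero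

/-! ### The standard involution as an autotopy -/

theorem IsHurwitz.mul_comm_of_finrank_le_two [FiniteDimensional k A] (h : IsHurwitz n)
    (hd : Module.finrank k A ≤ 2) (x y : A) : x * y = y * x := by
  have := h.nontrivial
  by_contra hne
  have commutator_ne : x * y - y * x ≠ 0 := sub_ne_zero.mpr hne
  have independent : LinearIndependent k ![1, x, y] := by
    refine Fintype.linearIndependent_iff.mpr fun g hg => ?_
    simp only [Fin.sum_univ_three, Matrix.cons_val] at hg
    have coeff_y : g 2 = 0 := (smul_eq_zero_iff_left commutator_ne).mp <| by
      have commutator := congrArg (fun z => x * z - z * x) hg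
      simp only [mul_add, add_mul, mul_smul_comm, smul_mul_assoc, mul_one, one_mul, mul_zero,
        zero_mul] at commutator
      linear_combination (norm := module) commutator
    have coeff_x : g 1 = 0 := (smul_eq_zero_iff_left commutator_ne).mp <| by
      have commutator := congrArg (fun z => z * y - y * z) hg
      simp only [mul_add, add_mul, mul_smul_comm, smul_mul_assoc, mul_one, one_mul, mul_zero,
        zero_mul] at commutator
      linear_combination (norm := module) commutator
    have coeff_one : g 0 = 0 := (smul_eq_zero_iff_left one_ne_zero).mp <| by
      rwa [coeff_x, coeff_y, zero_smul, zero_smul, add_zero, add_zero] at hg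
    exact Fin.forall_fin_succ.mpr ⟨coeff_one, Fin.forall_fin_two.mpr ⟨coeff_x, coeff_y⟩⟩
  have card_le := independent.fintype_card_le_finrank
  rw [Fintype.card_fin] at card_le
  omega

theorem IsHurwitz.eq_zero_of_commute (h : IsHurwitz n) {c : A} (hc : ∀ y, c * y = y * c)
    (htrace : polar n c 1 = 0) (hnorm : n c = 0) : c = 0 := by
  have c_sq : c * c = 0 := by rw [h.mul_self, htrace, hnorm, zero_smul, zero_smul, sub_zero]
  by_contra hne
  refine hne (h.nonDegenerate c fun y => (smul_eq_zero_iff_left hne).mp ?_)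
  have product := congrArg (c * ·) (h.mul_add_mul c y)
  simp only [← hc, mul_add, mul_sub, h.mul_mul_left, c_sq, htrace, mul_smul_comm, mul_one, zero_mul,
    smul_zero, zero_smul, add_zero, zero_add, zero_sub] at product
  rw [← neg_eq_zero, ← product]

-- For `b` central, left multiplication by `2 b - ⟨b, 1⟩ 1` takes values in the span of `b` and `1`.
theorem IsHurwitz.eq_smul_one_of_commute [FiniteDimensional k A] (h : IsHurwitz n)
    (hd : 2 < Module.finrank k A) {b : A} (hb : ∀ y, b * y = y * b) :
    ∃ c : k, b = c • (1 : A) := by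
  set c := (2 : k) • b - polar n b 1 • (1 : A) with hc
  have c_comm : ∀ y, c * y = y * c := fun y => by
    simp only [hc, sub_mul, mul_sub, smul_mul_assoc, mul_smul_comm, one_mul, mul_one, hb]
  have c_mul : ∀ y, c * y = polar n y 1 • b - polar n b y • (1 : A) := fun y => by
    have sum := h.mul_add_mul b y
    rw [← hb] at sum
    simp only [hc, sub_mul, smul_mul_assoc, one_mul]
    linear_combination (norm := module) sum
  have c_trace : polar n c 1 = 0 := by
    rw [hc, polar_sub_left, polar_smul_left, polar_smul_left, h.polar_one_one, smul_eq_mul,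
      smul_eq_mul, mul_comm, sub_self]
  have c_norm : n c = 0 := by
    by_contra hne
    have span_eq_top : Submodule.span k {b, (1 : A)} = ⊤ := by
      refine eq_top_iff.mpr fun x _ => ?_
      rw [← h.mul_inverse_cancel_left hne x, c_mul]
      exact sub_mem (Submodule.smul_mem _ _ (Submodule.mem_span_of_mem (.inl rfl)))
        (Submodule.smul_mem _ _ (Submodule.mem_span_of_mem (.inr rfl)))
    have finrank_le := finrank_span_pair_le (k := k) b (1 : A)
    rw [span_eq_top, finrank_top] at finrank_le
    omega
  obtain ⟨u, hu⟩ := h.exists_polar_one_eq_one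
  have b_eq := c_mul u
  rw [h.eq_zero_of_commute c_comm c_trace c_norm, zero_mul, hu, one_smul] at b_eq
  exact ⟨_, (sub_eq_zero.mp b_eq.symm)⟩

theorem IsHurwitz.mul_comm_of_opposite_isotopy [FiniteDimensional k A] (h : IsHurwitz n)
    (hd : 2 < Module.finrank k A) {f g : A → A} (hfg : ∀ x y, f x * g y = y * x) (x y : A) :
    x * y = y * x := by
  set b := g 1
  have f_mul_b : ∀ x, f x * b = x := fun x => by rw [hfg, one_mul]
  have hb0 : n b ≠ 0 := (h.norm_ne_zero_of_mul_eq_one (f_mul_b 1)).2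
  have f_eq : ∀ x, f x = x * inverse n b := fun x => by
    rw [← h.mul_inverse_cancel_right hb0 (f x), f_mul_b]
  have g_eq : ∀ y, g y = b * y := fun y => by
    rw [← h.mul_inverse_cancel_left hb0 (g y), ← one_mul (inverse n b), ← f_eq, hfg, mul_one]
  obtain ⟨c, hc⟩ := h.eq_smul_one_of_commute hd fun y => by
    rw [← hfg b y, f_eq, h.mul_inverse hb0, one_mul, g_eq]
  rw [← hfg x y, g_eq, hc, smul_mul_assoc, one_mul, mul_smul_comm, ← smul_mul_assoc,
    ← mul_smul_one, ← hc, f_mul_b]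

theorem IsHurwitz.reflection_one_mem_autotopyGroup [FiniteDimensional k A] (h : IsHurwitz n)
    (hd : Module.finrank k A ≤ 2) :
    reflection n 1 h.map_one_ne_zero ∈ autotopyGroup k A := by
  refine ⟨reflection n 1 h.map_one_ne_zero,
    LinearEquiv.neg k * reflection n 1 h.map_one_ne_zero, fun x y => ?_⟩
  rw [LinearEquiv.mul_apply, LinearEquiv.neg_apply, h.reflection_one_apply, h.reflection_one_apply,
    h.reflection_one_apply, h.bar_mul, h.mul_comm_of_finrank_le_two hd, neg_neg, neg_mul]

theorem IsHurwitz.reflection_one_notMem_autotopyGroup [FiniteDimensional k A] (h : IsHurwitz n)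
    (hd : 2 < Module.finrank k A) :
    reflection n 1 h.map_one_ne_zero ∉ autotopyGroup k A := by
  rintro ⟨φ₁, φ₂, hφ⟩
  have commutative := h.mul_comm_of_opposite_isotopy hd (f := fun x => -φ₁ (bar n x))
    (g := fun y => φ₂ (bar n y)) fun x y => by
      rw [neg_mul, ← hφ, h.reflection_one_apply, neg_neg, h.bar_mul, h.bar_bar, h.bar_bar]
  have finrank_le : Module.finrank k A ≤ 1 := finrank_le_one 1 fun x => by
    obtain ⟨c, hc⟩ := h.eq_smul_one_of_commute hd (commutative x)
    exact ⟨c, hc.symm⟩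
  omega

theorem IsHurwitz.autotopyGroup_eq_GO [FiniteDimensional k A] (h : IsHurwitz n)
    (hd : Module.finrank k A ≤ 2) : autotopyGroup k A = GO n := by
  refine le_antisymm h.autotopyGroup_le_GO fun φ hφ => ?_
  have reflection_mem := h.reflection_one_mem_autotopyGroup hd
  exact (h.mem_or_mul_reflection_one_mem (fun _ => h.leftEquiv_mem_autotopyGroup)
    (fun _ _ => h.reflection_mul_reflection_mem_autotopyGroup) hφ).elim id
    (mul_mem_cancel_right reflection_mem).mp

end Parity

/-! ### Determinants and Dickson invariants -/

section Properness

open Polynomial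

theorem charpoly_mul_charpoly_of_mul_self {ι R : Type*} [Fintype ι] [DecidableEq ι] [CommRing R]
    {M : Matrix ι ι R} {t c : R} (hM : M * M = t • M - c • 1) :
    M.charpoly * (t • 1 - M).charpoly = (X ^ 2 - C t * X + C c) ^ Fintype.card ι := by
  set N : Matrix ι ι R[X] := (C : R →+* R[X]).mapMatrix M with hN
  have map_smul_one (r : R) : (C : R →+* R[X]).mapMatrix (r • (1 : Matrix ι ι R)) = C r • 1 := by
    rw [Matrix.smul_one_eq_diagonal, Matrix.smul_one_eq_diagonal, RingHom.mapMatrix_apply,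
      Matrix.diagonal_map (map_zero _)]
  have N_mul_N : N * N = C t • N - C c • 1 := by
    rw [hN, ← map_mul, hM, map_sub, map_smul_one, ← smul_one_mul t M, map_mul, map_smul_one,
      smul_one_mul]
  have charmatrix_eq (P : Matrix ι ι R) :
      P.charmatrix = (X : R[X]) • 1 - (C : R →+* R[X]).mapMatrix P := by
    rw [Matrix.charmatrix, Matrix.scalar_apply, Matrix.smul_one_eq_diagonal]
  have charmatrix_mul : M.charmatrix * (t • 1 - M).charmatrix =
      (X ^ 2 - C t * X + C c) • (1 : Matrix ι ι R[X]) := by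
    rw [charmatrix_eq, charmatrix_eq, map_sub, map_smul_one, ← hN]
    simp only [mul_sub, sub_mul, smul_mul_assoc, mul_smul_comm, mul_one, one_mul, N_mul_N]
    module
  rw [Matrix.charpoly, Matrix.charpoly, ← Matrix.det_mul, charmatrix_mul, Matrix.det_smul,
    Matrix.det_one, mul_one]

variable {k V : Type*} [Field k] [AddCommGroup V] [Module k V]
  {q : QuadraticForm k V}

theorem NonDegenerate.polarBilin_nondegenerate (hq : NonDegenerate q) :
    q.polarBilin.Nondegenerate :=
  ⟨hq, fun y hy => hq y fun x => (polar_comm q y x).trans (hy x)⟩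

theorem coe_reflection {a : V} (ha : q a ≠ 0) : (reflection q a ha : Module.End k V) =
    1 - ((q a)⁻¹ • q.polarBilin a).smulRight a := rfl

variable [FiniteDimensional k V]

theorem charpoly_eq_of_isAdjointPair {B : LinearMap.BilinForm k V} (hB : B.Nondegenerate)
    {s t : Module.End k V} (hst : LinearMap.IsAdjointPair B B s t) : s.charpoly = t.charpoly := by
  classical
  let e := Module.finBasis k V
  set M := LinearMap.BilinForm.toMatrix e B with hM
  have isUnit_det : IsUnit M.det :=
    isUnit_iff_ne_zero.mpr ((LinearMap.BilinForm.nondegenerate_iff_det_ne_zero e).mp hB)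
  have transpose_mul : (LinearMap.toMatrix e e s).transpose * M = M * LinearMap.toMatrix e e t := by
    rw [hM, ← LinearMap.BilinForm.toMatrix_compRight, ← LinearMap.BilinForm.toMatrix_compLeft]
    exact congrArg _ (LinearMap.ext₂ hst)
  rw [← LinearMap.charpoly_toMatrix s e, ← LinearMap.charpoly_toMatrix t e,
    ← Matrix.charpoly_transpose (LinearMap.toMatrix e e s),
    ← Matrix.nonsing_inv_mul_cancel_left M (LinearMap.toMatrix e e t) isUnit_det, ← transpose_mul,
    Matrix.charpoly_mul_comm, Matrix.mul_nonsing_inv_cancel_right _ _ isUnit_det]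

theorem det_reflection {a : V} (ha : q a ≠ 0) :
    LinearMap.det (reflection q a ha : Module.End k V) = -1 := by
  have eq_transvection : (reflection q a ha : Module.End k V) =
      LinearMap.transvection ((q a)⁻¹ • q.polarBilin a) (-a) := by
    ext x
    rw [coe_reflection, LinearMap.transvection.apply, smul_neg, ← sub_eq_add_neg]
    rfl
  rw [eq_transvection, LinearMap.transvection.det, map_neg, inv_smul_polarBilin_self ha]
  norm_num

theorem dickson_reflection (h2 : (2 : k) = 0) {l : Module.End k V} (hl : Represents q l) {a : V}
    (ha : q a ≠ 0) : dickson l (reflection q a ha) = 1 := by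
  set f : Module.Dual k V := (q a)⁻¹ • q.polarBilin a with hf
  set N : Module.End k V := f.smulRight a
  have l_mul_N : l * N = f.smulRight (l a) := LinearMap.ext fun x => map_smul l (f x) a
  have f_l : f (l a) = 1 := by
    rw [hf, LinearMap.smul_apply, polarBilin_apply_apply, polar_comm, hl, smul_eq_mul,
      inv_mul_cancel₀ ha]
  have trace_l_mul_N : LinearMap.trace k V (l * N) = 1 := by
    rw [l_mul_N, LinearMap.trace_smulRight, f_l]
  have idempotent : l * N * (l * N) = l * N := by
    ext x
    rw [l_mul_N, Module.End.mul_apply, LinearMap.smulRight_apply, LinearMap.smulRight_apply,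
      map_smul, f_l, smul_eq_mul, mul_one]
  have expand : l * ((1 - N) * l * (1 - N) - l) = l * N * (l * N) - (l * N * l + l * (l * N)) := by
    noncomm_ring
  rw [dickson, reflection_inv, coe_reflection, expand, idempotent, map_sub, map_add,
    LinearMap.trace_mul_comm k (l * N), ← two_mul, h2, zero_mul, sub_zero, trace_l_mul_N]

theorem reflection_mul_reflection_mem_GOplus (hq : NonDegenerate q) {a b : V} (ha : q a ≠ 0)
    (hb : q b ≠ 0) : reflection q a ha * reflection q b hb ∈ GOplus q hq := by
  have hma := hasMultiplier_reflection ha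
  have hmb := hasMultiplier_reflection hb
  refine ⟨1 * 1, hma.mul hmb, fun _ => ?_, fun h2 l hl => ?_⟩
  · change LinearMap.det ((reflection q a ha : Module.End k V) *
      (reflection q b hb : Module.End k V)) = _
    rw [map_mul, det_reflection, det_reflection, mul_one, Units.val_one, one_pow, neg_mul_neg,
      mul_one]
  · rw [dickson_mul hq h2 hl hma hmb, dickson_reflection h2 hl, dickson_reflection h2 hl,
      one_add_one_eq_two, h2]

theorem dickson_eq (hq : NonDegenerate q) (h2 : (2 : k) = 0) {l l' : Module.End k V}
    (hl : Represents q l) (hl' : Represents q l') {φ : V ≃ₗ[k] V} {m : kˣ}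
    (hφ : HasMultiplier q φ m) : dickson l φ = dickson l' φ := by
  have dickson_sub : dickson l φ - dickson l' φ = LinearMap.trace k V ((l - l') * (conj φ l - l)) +
      LinearMap.trace k V ((conj φ⁻¹ l' - l') * (l - l')) := by
    rw [sub_mul (conj φ⁻¹ l'), map_sub, ← trace_conj_mul, ← map_sub, ← map_add, dickson, dickson,
      ← map_sub, ← conj, ← conj, conj_sub]
    congr 1
    noncomm_ring
  refine sub_eq_zero.mp ?_
  rw [dickson_sub,
    trace_alternating_mul hq h2 _ _ (hl.sub_alternating hl')
      ((represents_conj hφ hl).sub_alternating hl),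
    trace_alternating_mul hq h2 _ _ ((represents_conj hφ.inv hl').sub_alternating hl')
      (hl.sub_alternating hl'), add_zero]

end Properness

section LeftMultiplications

open Polynomial
open LinearMap hiding polar

variable {k A : Type*} [Field k] [NonAssocRing A] [Module k A]
  {n : QuadraticForm k A}

theorem IsHurwitz.polar_mul_self_eq_zero (h : IsHurwitz n) {p : A} (hp : polar n p 1 = 0) (x : A) :
    polar n (p * x) x = 0 := by
  have := h.polar_mul_right p 1 x
  rwa [one_mul, hp, zero_mul] at this

theorem IsHurwitz.exists_polar_one_eq_zero_norm_ne_zero (h : IsHurwitz n) (h2 : (2 : k) ≠ 0)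
    (hd : 1 < Module.finrank k A) : ∃ v, polar n v 1 = 0 ∧ n v ≠ 0 := by
  by_contra! hall
  have norm_eq (x : A) : 4 * n x = polar n x 1 * polar n x 1 := by
    have hall_x := hall ((2 : k) • x - polar n x 1 • 1) (by
      rw [polar_sub_left, polar_smul_left, polar_smul_left, h.polar_one_one, smul_eq_mul,
        smul_eq_mul, mul_comm, sub_self])
    rw [map_sub_eq, QuadraticMap.map_smul, h.map_smul_one, polar_smul_left, polar_smul_right,
      smul_eq_mul, smul_eq_mul, smul_eq_mul] at hall_x
    linear_combination hall_x
  have two_smul_eq (x : A) : (2 : k) • x = polar n x 1 • (1 : A) := by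
    refine h.nonDegenerate.ext fun y => mul_left_cancel₀ h2 ?_
    have e1 := norm_eq (x + y)
    rw [polar_add_left, QuadraticMap.map_add n x y] at e1
    rw [polar_smul_left, polar_smul_left, smul_eq_mul, smul_eq_mul, polar_comm n 1]
    linear_combination e1 - norm_eq x - norm_eq y
  refine hd.not_ge (finrank_le_one 1 fun x => ⟨2⁻¹ * polar n x 1, ?_⟩)
  rw [mul_smul, ← two_smul_eq, inv_smul_smul₀ h2]

variable [SMulCommClass k A A] [IsScalarTower k A A]

theorem lmul_one : mul k A 1 = 1 := LinearMap.ext one_mul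

namespace IsHurwitz

theorem lmul_bar (a : A) : mul k A (bar n a) = polar n a 1 • 1 - mul k A a := by
  rw [bar_apply, map_sub, map_smul, lmul_one]

theorem lmul_mul_self (h : IsHurwitz n) (a : A) :
    mul k A a * mul k A a = polar n a 1 • mul k A a - n a • 1 := by
  rw [← lmul_one, ← map_smul, ← map_smul, ← map_sub, ← h.mul_self]
  exact LinearMap.ext (h.mul_mul_left a)

theorem lmul_mul_add_lmul_mul (h : IsHurwitz n) (x y : A) :
    mul k A x * mul k A y + mul k A y * mul k A x = mul k A (x * y + y * x) := by
  ext z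
  have associators := h.associator_swap_left x y z
  rw [map_add]
  simp only [LinearMap.add_apply, Module.End.mul_apply, mul_apply']
  linear_combination (norm := module) -associators

theorem represents_lmul (h : IsHurwitz n) {u : A} (hu : polar n u 1 = 1) :
    Represents n (mul k A u) := fun x => by
  have := h.polar_mul_right u 1 x
  rwa [one_mul, hu, one_mul] at this

theorem trace_lmul_mul (h : IsHurwitz n) (x y : A) :
    trace k A (mul k A x * mul k A y) = trace k A (mul k A (x * y)) := by
  have associator_eq : mul k A (x * y) - mul k A x * mul k A y =
      mulRight k x * mul k A y - mul k A y * mulRight k x := by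
    ext z
    have swap_left := h.associator_swap_left x y z
    have swap_right := h.associator_swap_right y x z
    simp only [LinearMap.sub_apply, Module.End.mul_apply, mul_apply', mulRight_apply]
    linear_combination (norm := module) swap_left - swap_right
  have trace_eq := congrArg (trace k A) associator_eq
  rw [map_sub, map_sub, trace_mul_comm k (mulRight k x), sub_self] at trace_eq
  exact (sub_eq_zero.mp trace_eq).symm

variable [FiniteDimensional k A]

theorem charpoly_lmul_bar (h : IsHurwitz n) (a : A) :
    (mul k A (bar n a)).charpoly = (mul k A a).charpoly :=
  (charpoly_eq_of_isAdjointPair h.nonDegenerate.polarBilin_nondegenerate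
    fun x y => h.polar_mul_eq_bar_mul a x y).symm

theorem charpoly_lmul_sq (h : IsHurwitz n) (a : A) :
    (mul k A a).charpoly * (mul k A a).charpoly =
      (X ^ 2 - C (polar n a 1) * X + C (n a)) ^ Module.finrank k A := by
  let e := Module.finBasis k A
  have matrix_mul_self : toMatrixAlgEquiv e (mul k A a) * toMatrixAlgEquiv e (mul k A a) =
      polar n a 1 • toMatrixAlgEquiv e (mul k A a) - n a • 1 := by
    rw [← _root_.map_mul, h.lmul_mul_self, map_sub, map_smul, map_smul, _root_.map_one]
  have matrix_bar : toMatrixAlgEquiv e (mul k A (bar n a)) =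
      polar n a 1 • 1 - toMatrixAlgEquiv e (mul k A a) := by
    rw [lmul_bar, map_sub, map_smul, _root_.map_one]
  have key := charpoly_mul_charpoly_of_mul_self matrix_mul_self
  rw [← matrix_bar, Fintype.card_fin] at key
  nth_rw 2 [← h.charpoly_lmul_bar]
  exact (congrArg₂ _ (charpoly_toMatrix _ e) (charpoly_toMatrix _ e)).symm.trans key

theorem even_finrank (h : IsHurwitz n) (h2 : (2 : k) ≠ 0) (hd : 1 < Module.finrank k A) :
    Even (Module.finrank k A) := by
  obtain ⟨v, hv1, hv⟩ := h.exists_polar_one_eq_zero_norm_ne_zero h2 hd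
  have bar_v : mul k A (bar n v) = (-1 : k) • mul k A v := by
    rw [lmul_bar, hv1, zero_smul, zero_sub, neg_one_smul]
  have det_eq : (-1) ^ Module.finrank k A * LinearMap.det (mul k A v) =
      LinearMap.det (mul k A v) := by
    rw [← LinearMap.det_smul, ← bar_v, det_eq_sign_charpoly_coeff, h.charpoly_lmul_bar,
      ← det_eq_sign_charpoly_coeff]
  have det_ne_zero : LinearMap.det (mul k A v) ≠ 0 := (h.leftEquiv hv).isUnit_det'.ne_zero
  by_contra hodd
  rw [(Nat.not_even_iff_odd.mp hodd).neg_one_pow] at det_eq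
  exact mul_ne_zero h2 det_ne_zero (by linear_combination -det_eq)

theorem det_leftEquiv (h : IsHurwitz n) (h2 : (2 : k) ≠ 0) (hd : 1 < Module.finrank k A) {a : A}
    (ha : n a ≠ 0) :
    LinearMap.det (h.leftEquiv ha : Module.End k A) = n a ^ (Module.finrank k A / 2) := by
  have even := h.even_finrank h2 hd
  set Q : k[X] := X ^ 2 - C (polar n a 1) * X + C (n a) with hQ
  have charpoly_eq : (mul k A a).charpoly = Q ^ (Module.finrank k A / 2) := by
    have Q_monic : (Q ^ (Module.finrank k A / 2)).Monic := Monic.pow (by rw [hQ]; monicity!) _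
    have squares_eq : (mul k A a).charpoly * (mul k A a).charpoly =
        Q ^ (Module.finrank k A / 2) * Q ^ (Module.finrank k A / 2) := by
      rw [h.charpoly_lmul_sq, ← pow_add, ← two_mul, Nat.two_mul_div_two_of_even even]
    refine (mul_self_eq_mul_self_iff.mp squares_eq).resolve_right fun eq_neg => h2 ?_
    have leadingCoeff_eq := congrArg leadingCoeff eq_neg
    rw [leadingCoeff_neg, Q_monic.leadingCoeff, (charpoly_monic _).leadingCoeff] at leadingCoeff_eq
    linear_combination leadingCoeff_eq
  change LinearMap.det (mul k A a) = _
  rw [det_eq_sign_charpoly_coeff, charpoly_eq, even.neg_one_pow, one_mul, coeff_zero_eq_eval_zero,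
    eval_pow]
  simp [hQ]

section CharTwo

variable (h : IsHurwitz n) (h2 : (2 : k) = 0)
include h h2

theorem trace_lmul_of_polar_one_eq_zero {p : A} (hp : polar n p 1 = 0) :
    trace k A (mul k A p) = 0 := by
  rw [← mul_one (mul k A p)]
  exact trace_alternating_mul h.nonDegenerate h2 _ 1 (h.polar_mul_self_eq_zero hp) fun x => by
    rw [Module.End.one_apply, polar_self, nsmul_eq_mul, Nat.cast_ofNat, h2, zero_mul]

theorem trace_lmul (hd : 2 < Module.finrank k A) (a : A) : trace k A (mul k A a) = 0 := by
  obtain ⟨u, hu⟩ := h.exists_polar_one_eq_one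
  have polar_sub (x : A) : polar n (x - polar n x 1 • u) 1 = 0 := by
    rw [polar_sub_left, polar_smul_left, hu, smul_eq_mul, mul_one, sub_self]
  have trace_eq (x : A) : trace k A (mul k A x) = polar n x 1 * trace k A (mul k A u) := by
    have := h.trace_lmul_of_polar_one_eq_zero h2 (polar_sub x)
    rwa [map_sub, map_smul, map_sub, map_smul, sub_eq_zero] at this
  rw [trace_eq]
  refine mul_eq_zero_of_right _ ?_
  by_contra trace_ne_zero
  have polar_eq_zero {p r : A} (hp : polar n p 1 = 0) (hr : polar n r 1 = 0) :
      polar n p r = 0 := by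
    have trace_mul := trace_alternating_mul h.nonDegenerate h2 (mul k A p) (mul k A r)
      (h.polar_mul_self_eq_zero hp) (h.polar_mul_self_eq_zero hr)
    rw [h.trace_lmul_mul, trace_eq] at trace_mul
    have := (mul_eq_zero.mp trace_mul).resolve_right trace_ne_zero
    rwa [h.polar_mul_eq_mul_bar, one_mul, bar_apply, hr, zero_smul, zero_sub, polar_neg_right,
      neg_eq_zero] at this
  have eq_smul_one {p : A} (hp : polar n p 1 = 0) : p = polar n p u • (1 : A) := by
    refine h.nonDegenerate.ext fun y => ?_
    have := polar_eq_zero hp (polar_sub y)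
    rw [polar_sub_right, polar_smul_right, sub_eq_zero, smul_eq_mul] at this
    rw [this, polar_smul_left, smul_eq_mul, polar_comm n 1, mul_comm]
  have span_eq_top : Submodule.span k {u, (1 : A)} = ⊤ := by
    refine eq_top_iff.mpr fun x _ => ?_
    rw [← add_sub_cancel (polar n x 1 • u) x, eq_smul_one (polar_sub x)]
    exact add_mem (Submodule.smul_mem _ _ (Submodule.mem_span_of_mem (.inl rfl)))
      (Submodule.smul_mem _ _ (Submodule.mem_span_of_mem (.inr rfl)))
  have finrank_le := finrank_span_pair_le (k := k) u (1 : A)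
  rw [span_eq_top, finrank_top] at finrank_le
  omega

theorem dickson_leftEquiv (hd : 2 < Module.finrank k A) {a : A} (ha : n a ≠ 0)
    {l : Module.End k A} (hl : Represents n l) : dickson l (h.leftEquiv ha) = 0 := by
  obtain ⟨u, hu⟩ := h.exists_polar_one_eq_one
  set b := inverse n a
  set c := polar n a u
  have lmul_mul_lmul : mul k A a * mul k A b = 1 := LinearMap.ext (h.mul_inverse_cancel_left ha)
  have swap : mul k A a * mul k A u =
      polar n a 1 • mul k A u + mul k A a - c • 1 - mul k A u * mul k A a := by
    rw [eq_sub_iff_add_eq, h.lmul_mul_add_lmul_mul, h.mul_add_mul, hu, one_smul, map_sub, map_add,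
      map_smul, map_smul, lmul_one]
  have expand : mul k A u * (mul k A a * mul k A u * mul k A b - mul k A u) =
      polar n a 1 • (mul k A u * mul k A b) - (polar n a 1 * n u) • mul k A b + mul k A u -
        c • (mul k A u * mul k A b) - (2 : k) • (mul k A u * mul k A u) := by
    have square (f : Module.End k A) : mul k A u * (mul k A u * f) = mul k A u * f - n u • f := by
      rw [← mul_assoc, h.lmul_mul_self, hu, one_smul, sub_mul, smul_one_mul]
    rw [swap]
    simp only [add_mul, sub_mul, mul_add, mul_sub, smul_mul_assoc, mul_smul_comm, mul_assoc,
      lmul_mul_lmul, square, one_mul, mul_one]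
    module
  have hmul : HasMultiplier n (h.leftEquiv ha) (Units.mk0 (n a) ha) := h.map_mul a
  rw [dickson_eq h.nonDegenerate h2 hl (h.represents_lmul hu) hmul]
  change trace k A (mul k A u * (mul k A a * mul k A u * mul k A b - mul k A u)) = 0
  rw [expand]
  simp only [map_add, map_sub, map_smul, h.trace_lmul_mul, h.trace_lmul h2 hd, smul_zero, add_zero,
    sub_zero]

end CharTwo

theorem leftEquiv_mem_GOplus (h : IsHurwitz n) (hd : 2 < Module.finrank k A) {a : A}
    (ha : n a ≠ 0) : h.leftEquiv ha ∈ GOplus n h.nonDegenerate :=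
  ⟨Units.mk0 (n a) ha, h.map_mul a, fun h2 => h.det_leftEquiv h2 (one_lt_two.trans hd) ha,
    fun h2 _ => h.dickson_leftEquiv h2 hd ha⟩

theorem reflection_one_notMem_GOplus (h : IsHurwitz n) :
    reflection n 1 h.map_one_ne_zero ∉ GOplus n h.nonDegenerate := by
  rintro ⟨m, hm, det_eq, dickson_eq_zero⟩
  have m_eq_one : (m : k) = 1 := by
    have := hm 1
    rwa [hasMultiplier_reflection h.map_one_ne_zero, h.map_one, mul_one, mul_one, Units.val_one,
      eq_comm] at this
  by_cases h2 : (2 : k) = 0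
  · obtain ⟨u, hu⟩ := h.exists_polar_one_eq_one
    have := dickson_eq_zero h2 _ (h.represents_lmul hu)
    rw [dickson_reflection h2 (h.represents_lmul hu)] at this
    exact one_ne_zero this
  · have := det_eq h2
    rw [det_reflection, m_eq_one, one_pow] at this
    exact h2 (by linear_combination -this)

theorem autotopyGroup_eq_GOplus (h : IsHurwitz n) (hd : 2 < Module.finrank k A) :
    autotopyGroup k A = GOplus n h.nonDegenerate := by
  have leftEquiv_mem (a : A) (ha : n a ≠ 0) :
      h.leftEquiv ha ∈ autotopyGroup k A ⊓ GOplus n h.nonDegenerate :=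
    ⟨h.leftEquiv_mem_autotopyGroup ha, h.leftEquiv_mem_GOplus hd ha⟩
  have reflections_mem (a b : A) (ha : n a ≠ 0) (hb : n b ≠ 0) :
      reflection n a ha * reflection n b hb ∈ autotopyGroup k A ⊓ GOplus n h.nonDegenerate :=
    ⟨h.reflection_mul_reflection_mem_autotopyGroup ha hb,
      reflection_mul_reflection_mem_GOplus h.nonDegenerate ha hb⟩
  have mem_or {φ : A ≃ₗ[k] A} (hφ : φ ∈ GO n) :=
    h.mem_or_mul_reflection_one_mem leftEquiv_mem reflections_mem hφ
  refine le_antisymm (fun φ hφ => ?_) fun φ hφ => ?_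
  · exact ((mem_or (h.autotopyGroup_le_GO hφ)).resolve_right fun hmem =>
      h.reflection_one_notMem_autotopyGroup hd ((mul_mem_cancel_left hφ).mp hmem.1)).2
  · obtain ⟨m, hm, -⟩ := id hφ
    exact ((mem_or ⟨m, hm⟩).resolve_right fun hmem =>
      h.reflection_one_notMem_GOplus ((mul_mem_cancel_left hφ).mp hmem.2)).1

theorem G_eq_autotopyGroup (h : IsHurwitz n) : G n h = autotopyGroup k A := by
  rw [G]
  split_ifs with hd
  · exact (h.autotopyGroup_eq_GO hd).symm
  · exact (h.autotopyGroup_eq_GOplus (not_le.mp hd)).symm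

end IsHurwitz

end LeftMultiplications

/-! ### The triality action -/

section OrbitSet

variable {k A : Type*} [Field k] [NonAssocRing A] [Module k A]

theorem PGL.mk_eq_mk_iff {φ ψ : A ≃ₗ[k] A} :
    (φ : PGL k A) = (ψ : PGL k A) ↔ ∃ c : kˣ, ∀ x, ψ x = (c : k) • φ x := by
  rw [QuotientGroup.eq]
  refine exists_congr fun c => ?_
  rw [eq_inv_mul_iff_mul_eq, LinearEquiv.ext_iff]
  exact forall_congr' fun x => eq_comm.trans (Eq.congr_right (map_smul φ (c : k) x))

theorem PrincipalIsotope.exists_mul_eq (B : PrincipalIsotope k A) (z : A) :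
    ∃ x y, B.mul x y = z := by
  obtain ⟨α, β, hB⟩ := B.exists_isotopy
  refine ⟨α.symm z, β.symm 1, ?_⟩
  rw [hB, α.apply_symm_apply, β.apply_symm_apply, mul_one]

variable [SMulCommClass k A A] [IsScalarTower k A A] {n : QuadraticForm k A}

theorem rightMul_inv_mul_leftMul (w : (nucleus A)ˣ) (x y : A) :
    (rightMul k w)⁻¹ x * leftMul k w y = x * y := by
  obtain ⟨z, rfl⟩ := (rightMul k w).surjective x
  exact (congrArg (· * _) ((rightMul k w).symm_apply_apply z)).trans
    ((w : nucleus A).2 z y).2.1.symm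

theorem XSet.mk_eq_mk_iff_exists_unit {α β α' β' : A ≃ₗ[k] A} :
    XSet.mk α β = XSet.mk α' β' ↔ ∃ w : (nucleus A)ˣ,
      (((rightMul k w)⁻¹ * α' : A ≃ₗ[k] A) : PGL k A) = α ∧
        ((leftMul k w * β' : A ≃ₗ[k] A) : PGL k A) = β :=
  Quotient.eq.trans (exists_congr fun _ => Prod.ext_iff)

theorem XSet.mk_eq_mk_iff (h : IsHurwitz n) {α β α' β' : A ≃ₗ[k] A} :
    XSet.mk α β = XSet.mk α' β' ↔ ∃ c : kˣ, ∀ x y, α x * β y = (c : k) • (α' x * β' y) := by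
  simp only [XSet.mk_eq_mk_iff_exists_unit, PGL.mk_eq_mk_iff]
  constructor
  · rintro ⟨w, ⟨c, hα⟩, ⟨d, hβ⟩⟩
    refine ⟨c * d, fun x y => ?_⟩
    rw [hα, hβ, smul_mul_smul_comm, Units.val_mul, LinearEquiv.mul_apply, LinearEquiv.mul_apply,
      rightMul_inv_mul_leftMul]
  · rintro ⟨c, hc⟩
    obtain ⟨w, hw⟩ := h.exists_nucleus_unit (f := fun x => (c⁻¹ : kˣ) • α (α'.symm x))
      (g := fun y => β (β'.symm y)) fun x y => by
        rw [smul_mul_assoc, hc, α'.apply_symm_apply, β'.apply_symm_apply]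
        exact inv_smul_smul c (x * y)
    refine ⟨w, ⟨c, fun x => ?_⟩, ⟨1, fun y => ?_⟩⟩
    · have hα := (hw (α' x)).1
      rw [α'.symm_apply_apply, smul_mul_assoc, inv_smul_eq_iff] at hα
      rw [LinearEquiv.mul_apply, ← map_smul]
      exact (LinearEquiv.eq_symm_apply _).mpr hα
    · have hβ := (hw (β' y)).2
      rw [β'.symm_apply_apply] at hβ
      rw [Units.val_one, one_smul, hβ]
      rfl

namespace PrincipalIsotope

/-- The class in `X_A` of a principal isotope `A_{α,β}`, computed from a choice of `α` and `β`. -/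
noncomputable def toXSet (B : PrincipalIsotope k A) : XSet k A :=
  XSet.mk B.exists_isotopy.choose B.exists_isotopy.choose_spec.choose

theorem toXSet_eq_iff (h : IsHurwitz n) {B C : PrincipalIsotope k A} :
    B.toXSet = C.toXSet ↔ ∃ c : kˣ, ∀ x y, B.mul x y = (c : k) • C.mul x y := by
  refine (XSet.mk_eq_mk_iff h).trans (exists_congr fun c => forall₂_congr fun x y => ?_)
  rw [← B.exists_isotopy.choose_spec.choose_spec, ← C.exists_isotopy.choose_spec.choose_spec]

theorem toXSet_isotope (h : IsHurwitz n) (α β : A ≃ₗ[k] A) :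
    (isotope α β).toXSet = XSet.mk α β :=
  (XSet.mk_eq_mk_iff h).mpr ⟨1, fun x y => by
    rw [← (isotope α β).exists_isotopy.choose_spec.choose_spec, Units.val_one, one_smul]
    rfl⟩

theorem toXSet_surjective (h : IsHurwitz n) :
    Function.Surjective (toXSet : PrincipalIsotope k A → XSet k A) := by
  rintro ⟨⟨⟨α⟩, ⟨β⟩⟩⟩
  exact ⟨isotope α β, toXSet_isotope h α β⟩

end PrincipalIsotope

end OrbitSet

section Action

variable {k A : Type*} [Field k] [NonAssocRing A] [Module k A] [FiniteDimensional k A]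
  {n : QuadraticForm k A} {h : IsHurwitz n}

theorem PG.mk_eq_mk_iff {φ ψ : G n h} : (φ : PG n h) = (ψ : PG n h) ↔
    ∃ c : kˣ, ∀ x, (ψ : A ≃ₗ[k] A) x = (c : k) • (φ : A ≃ₗ[k] A) x := by
  rw [← PGL.mk_eq_mk_iff, QuotientGroup.eq, QuotientGroup.eq, Subgroup.mem_subgroupOf]
  rfl

variable [SMulCommClass k A A] [IsScalarTower k A A]

theorem exists_isTriality (φ : G n h) : ∃ φ₁ φ₂ : A ≃ₗ[k] A, IsTriality n φ φ₁ φ₂ := by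
  obtain ⟨φ₁, φ₂, hφ⟩ := h.G_eq_autotopyGroup.le φ.2
  exact ⟨φ₁, φ₂, h.isTriality_of_autotopy hφ⟩

/-- Transport of the multiplication of a principal isotope along an element of `G(A)`. -/
instance : MulAction (G n h) (PrincipalIsotope k A) where
  smul φ B :=
    { mul := (B.mul.compl₁₂ ((φ : A ≃ₗ[k] A).symm : A →ₗ[k] A)
        ((φ : A ≃ₗ[k] A).symm : A →ₗ[k] A)).compr₂ ((φ : A ≃ₗ[k] A) : A →ₗ[k] A)
      exists_isotopy := by
        obtain ⟨α, β, hB⟩ := B.exists_isotopy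
        obtain ⟨φ₁, φ₂, hφ⟩ := exists_isTriality φ
        refine ⟨φ₁ * α * (φ : A ≃ₗ[k] A)⁻¹, φ₂ * β * (φ : A ≃ₗ[k] A)⁻¹, fun x y => ?_⟩
        exact (congrArg (φ : A ≃ₗ[k] A) (hB _ _)).trans (hφ.map_mul _ _) }
  one_smul _ := rfl
  mul_smul _ _ _ := rfl

theorem smul_mul_apply (φ : G n h) (B : PrincipalIsotope k A) (x y : A) :
    (φ • B).mul ((φ : A ≃ₗ[k] A) x) ((φ : A ≃ₗ[k] A) y) = (φ : A ≃ₗ[k] A) (B.mul x y) :=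
  congrArg (φ : A ≃ₗ[k] A) (congrArg₂ (fun x y => B.mul x y)
    ((φ : A ≃ₗ[k] A).symm_apply_apply x) ((φ : A ≃ₗ[k] A).symm_apply_apply y))

theorem smul_isotope {φ : G n h} {φ₁ φ₂ : A ≃ₗ[k] A} (hφ : IsTriality n φ φ₁ φ₂)
    (α β : A ≃ₗ[k] A) : φ • isotope α β =
      isotope (φ₁ * α * (φ : A ≃ₗ[k] A)⁻¹) (φ₂ * β * (φ : A ≃ₗ[k] A)⁻¹) :=
  PrincipalIsotope.ext <| LinearMap.ext₂ fun _ _ => hφ.map_mul _ _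

theorem toXSet_smul_eq {B C : PrincipalIsotope k A} {φ ψ : G n h}
    (hφψ : (φ : PG n h) = (ψ : PG n h)) (hBC : B.toXSet = C.toXSet) :
    (φ • B).toXSet = (ψ • C).toXSet := by
  obtain ⟨c, hc⟩ := (PrincipalIsotope.toXSet_eq_iff h).mp hBC
  obtain ⟨d, hd⟩ := PG.mk_eq_mk_iff.mp hφψ
  refine (PrincipalIsotope.toXSet_eq_iff h).mpr ⟨c * d, fun x y => ?_⟩
  obtain ⟨x, rfl⟩ := (ψ : A ≃ₗ[k] A).surjective x
  obtain ⟨y, rfl⟩ := (ψ : A ≃ₗ[k] A).surjective y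
  rw [smul_mul_apply, hd, hd, map_smul, LinearMap.map_smul₂, smul_mul_apply, hc, hd, map_smul,
    Units.val_mul]
  simp only [smul_smul]
  ring_nf

/-- Transport of a class in `X_A` along an element of `PG(A)`, computed from chosen representatives;
by `mk_smul_toXSet` the choices do not matter. -/
noncomputable instance : SMul (PG n h) (XSet k A) :=
  ⟨fun g x => (g.out • Function.surjInv (PrincipalIsotope.toXSet_surjective h) x).toXSet⟩

theorem mk_smul_toXSet (φ : G n h) (B : PrincipalIsotope k A) :
    (φ : PG n h) • B.toXSet = (φ • B).toXSet :=
  toXSet_smul_eq (QuotientGroup.out_eq' _) (Function.surjInv_eq _ _)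

/-- The action of `PG(A)` on `X_A` by triality components. -/
noncomputable instance trialityAction : MulAction (PG n h) (XSet k A) where
  one_smul := (PrincipalIsotope.toXSet_surjective h).forall.mpr fun B => by
    rw [← QuotientGroup.mk_one, mk_smul_toXSet, one_smul]
  mul_smul := QuotientGroup.mk_surjective.forall₂.mpr fun φ ψ =>
    (PrincipalIsotope.toXSet_surjective h).forall.mpr fun B => by
      rw [← QuotientGroup.mk_mul, mk_smul_toXSet, mk_smul_toXSet, mk_smul_toXSet, mul_smul]

theorem isTrialityAction (h : IsHurwitz n) : IsTrialityAction n h trialityAction where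
  exists_components := exists_isTriality
  smul_mk φ φ₁ φ₂ hφ α β := by
    rw [← PrincipalIsotope.toXSet_isotope h, ← PrincipalIsotope.toXSet_isotope h, ← smul_isotope hφ]
    exact mk_smul_toXSet φ _

end Action

/-! ### The equivalence of groupoids -/

section Equivalence

variable {k A : Type*} [Field k] [NonAssocRing A] [Module k A] [SMulCommClass k A A]
  [IsScalarTower k A A] [FiniteDimensional k A] {n : QuadraticForm k A}

namespace PrincipalIsotope.Iso

variable {B C : PrincipalIsotope k A}

theorem mem_G (h : IsHurwitz n) (f : Iso B C) : f.toLinearEquiv ∈ G n h := by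
  obtain ⟨α, β, hB⟩ := B.exists_isotopy
  obtain ⟨γ, δ, hC⟩ := C.exists_isotopy
  rw [h.G_eq_autotopyGroup]
  refine ⟨γ * f.toLinearEquiv * α⁻¹, δ * f.toLinearEquiv * β⁻¹, fun x y => ?_⟩
  obtain ⟨x, rfl⟩ := α.surjective x
  obtain ⟨y, rfl⟩ := β.surjective y
  rw [← hB, f.map_mul, hC]
  exact congrArg₂ (fun x y => γ (f.toLinearEquiv x) * δ (f.toLinearEquiv y))
    (α.symm_apply_apply x).symm (β.symm_apply_apply y).symm

theorem smul_eq (h : IsHurwitz n) (f : Iso B C) :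
    (⟨f.toLinearEquiv, f.mem_G h⟩ : G n h) • B = C := by
  refine PrincipalIsotope.ext (LinearMap.ext₂ fun x y => ?_)
  obtain ⟨x, rfl⟩ := f.toLinearEquiv.surjective x
  obtain ⟨y, rfl⟩ := f.toLinearEquiv.surjective y
  exact (smul_mul_apply (h := h) ⟨f.toLinearEquiv, f.mem_G h⟩ B x y).trans (f.map_mul x y)

end PrincipalIsotope.Iso

/-- The functor `F_A`, sending `A_{α,β}` to the class of `(α, β)` and an isomorphism to its class
in `PG(A)`. -/
noncomputable def isotopeFunctor (h : IsHurwitz n) :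
    PrincipalIsotope k A ⥤ ActionCategory (PG n h) (XSet k A) where
  obj B := ⟨(), B.toXSet⟩
  map f := ⟨((⟨f.toLinearEquiv, f.mem_G h⟩ : G n h) : PG n h),
    (mk_smul_toXSet _ _).trans (congrArg PrincipalIsotope.toXSet (f.smul_eq h))⟩
  map_id _ := rfl
  map_comp _ _ := rfl

instance isotopeFunctor_faithful (h : IsHurwitz n) : (isotopeFunctor h).Faithful where
  map_injective {B C} f g hfg := by
    have := h.nontrivial
    obtain ⟨c, hc⟩ : ∃ c : kˣ, ∀ x, g.toLinearEquiv x = (c : k) • f.toLinearEquiv x :=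
      PG.mk_eq_mk_iff.mp (congrArg Subtype.val hfg)
    -- Both maps are multiplicative and products exhaust the isotope, so `c = c ^ 2`.
    obtain ⟨x, y, hxy⟩ := B.exists_mul_eq (f.toLinearEquiv.symm 1)
    have hf : C.mul (f.toLinearEquiv x) (f.toLinearEquiv y) = 1 := by
      rw [← f.map_mul, hxy, LinearEquiv.apply_symm_apply]
    have hg : (c : k) • (1 : A) = (c * c : k) • (1 : A) := by
      have := g.map_mul x y
      rwa [hc, hc, hc, map_smul, LinearMap.map_smul₂, f.map_mul, hf, smul_smul] at this
    have hc_one : (c : k) = 1 :=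
      (mul_eq_left₀ c.ne_zero).mp (smul_left_injective k one_ne_zero hg).symm
    refine PrincipalIsotope.Iso.ext (LinearEquiv.ext fun z => ?_)
    rw [hc, hc_one, one_smul]

instance isotopeFunctor_full (h : IsHurwitz n) : (isotopeFunctor h).Full where
  map_surjective {B C} := by
    rintro ⟨g, hg⟩
    obtain ⟨φ, rfl⟩ := QuotientGroup.mk_surjective g
    have hφ : (φ • B).toXSet = C.toXSet := (mk_smul_toXSet φ B).symm.trans hg
    obtain ⟨c, hc⟩ := (PrincipalIsotope.toXSet_eq_iff h).mp hφ
    let ψ : B ⟶ C := ⟨DistribMulAction.toModuleAut k A c * φ, fun x y => by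
      change (c : k) • (φ : A ≃ₗ[k] A) (B.mul x y) =
        C.mul ((c : k) • (φ : A ≃ₗ[k] A) x) ((c : k) • (φ : A ≃ₗ[k] A) y)
      rw [← smul_mul_apply, hc, map_smul, LinearMap.map_smul₂]⟩
    exact ⟨ψ, Subtype.ext (PG.mk_eq_mk_iff.mpr ⟨c, fun _ => rfl⟩).symm⟩

instance isotopeFunctor_essSurj (h : IsHurwitz n) : (isotopeFunctor h).EssSurj where
  mem_essImage := by
    rintro ⟨⟨⟩, x⟩
    obtain ⟨B, rfl⟩ := PrincipalIsotope.toXSet_surjective h x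
    exact ⟨B, ⟨Iso.refl _⟩⟩

end Equivalence

end HurwitzIsotope

open HurwitzIsotope CategoryTheory in
theorem theorem2p7 {k : Type*} {A : Type*} [Field k] [NonAssocRing A] [Module k A]
    [SMulCommClass k A A] [IsScalarTower k A A] [FiniteDimensional k A]
    (n : QuadraticForm k A) (h : IsHurwitz n) :
    ∃ act : MulAction (PG n h) (XSet k A), IsTrialityAction n h act ∧
      ∃ F : PrincipalIsotope k A ⥤ ActionCategory (PG n h) (XSet k A),
        F.IsEquivalence ∧
        (∀ α β : A ≃ₗ[k] A, (F.obj (isotope α β)).back = XSet.mk α β) ∧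
        (∀ (B C : PrincipalIsotope k A) (f : B ⟶ C), ∃ hf : f.toLinearEquiv ∈ G n h,
          ((F.map f).val : PG n h) = ((⟨f.toLinearEquiv, hf⟩ : G n h) : PG n h)) :=
  ⟨trialityAction, isTrialityAction h, isotopeFunctor h, {},
    PrincipalIsotope.toXSet_isotope h, fun _ _ f => ⟨f.mem_G h, rfl⟩⟩
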